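/- Let $X$ be a path connected, compactly generated space with a non-degenerate base point $*$, having the homotopy type of a CW complex. Products are taken in compactly generated spaces. $[Z,Y]$ denotes pointed homotopy classes of pointed maps, and $X^{(2)}=X\wedge X$. Assume that $X$ has weak LS-category less than $2$, i.e. the reduced diagonal $\bar\Delta\colon X\to X\wedge X$ is null homotopic. Let $J(X)$ be the James construction (the free topological monoid on $X$ with $*$ as unit, with the quotient topology from $\bigsqcup_k X^k$), let $E\colon X\to J(X)$ be the canonical map, let $J_n(X)$ be the coequalizer of the inclusions $i_j\colon X^{n-1}\to X^n$ ($1\le j\le n$) that insert $*$ in the $j$-th place, and let $q_n\colon X^n\to J_n(X)$ be the quotient map. The sets $[X^n,J(X)]$ and $[J_n(X),J(X)]$ are given the multiplication induced by that of $J(X)$. Let $x_i\in[X^n,J(X)]$ be the class of $X^n\xrightarrow{p_i}X\xrightarrow{E}J(X)$, where $p_i$ is the $i$-th coordinate projection. Let $K_n(X)\subseteq[X^n,J(X)]$ be the subgroup generated by $x_1,\dots,x_n$, and let $\mathcal H_n(X)\subseteq[J_n(X),J(X)]$ be the subgroup of classes $\beta$ with $q_n^*\beta\in K_n(X)$. Write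 $[x,y]=x^{-1}y^{-1}xy$ and $[[a_1,\dots,a_l]=[\cdots[a_1,a_2],\cdots,a_l]$ for $l\ge 1$. Let $K_n$ be the group with generators $x_1,\dots,x_n$ and relations, for all $l\ge1$, all indices $i_1,\dots,i_l$ and all integers $m_1,\dots,m_l$, $$[[x_{i_1},\dots,x_{i_l}]=1\ \text{ if } i_s=i_t \text{ for some } s<t,\qquad [[x_{i_1}^{m_1},\dots,x_{i_l}^{m_l}]=[[x_{i_1},\dots,x_{i_l}]^{m_1\cdots m_l}.$$ For $1\le j\le n$ let $d_j\colon K_n\to K_{n-1}$ be the homomorphism with $d_j(x_i)=x_i$ for $i<j$, $d_j(x_j)=1$, and $d_j(x_i)=x_{i-1}$ for $i>j$. Let $\mathcal H_n=\{a\in K_n : d_1(a)=\dots=d_n(a)\}$ be their equalizer (so $\mathcal H_0=K_0$). Then for every $n\ge 0$ the monoids $[X^n,J(X)]$ and $[J_n(X),J(X)]$ are groups, and there are homomorphisms $$e_X\colon K_n\to K_n(X)\subseteq[X^n,J(X)],\quad e_X(x_i)=x_i,\qquad\qquad e_X\colon \mathcal H_n\to\mathcal H_n(X)\subseteq[J_n(X),J(X)]$$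 such that $q_n^*(e_X(a))=e_X(a)$ in $[X^n,J(X)]$ for every $a\in\mathcal H_n$, where the left-hand $e_X$ is the one on $\mathcal H_n$ and the right-hand one is that on $K_n$. -/

import Mathlib

open TopologicalSpace Topology

universe u

/-! ### Combinatorial groups -/

section Combinatorial

/-- The commutator with the convention `[x, y] = x⁻¹ y⁻¹ x y`. -/
def rightComm {G : Type*} [Group G] (x y : G) : G := x⁻¹ * y⁻¹ * x * y

/-- The left-normed iterated commutator `[[a₀, a₁, …, a_l] = [⋯[a₀, a₁], ⋯, a_l]` of a nonempty
list of elements (of length `l + 1`). -/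
def iterComm {G : Type*} [Group G] : (l : ℕ) → (Fin (l + 1) → G) → G
  | 0, a => a 0
  | l + 1, a => rightComm (iterComm l fun s => a s.castSucc) (a (Fin.last (l + 1)))

theorem map_iterComm {G H : Type*} [Group G] [Group H] (f : G →* H) :
    ∀ (l : ℕ) (a : Fin (l + 1) → G), f (iterComm l a) = iterComm l fun s => f (a s)
  | 0, a => rfl
  | l + 1, a => by simp [iterComm, rightComm, map_iterComm f l]

theorem iterComm_eq_one {G : Type*} [Group G] :
    ∀ (l : ℕ) (a : Fin (l + 1) → G), (∃ s, a s = 1) → iterComm l a = 1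
  | 0, a, ⟨s, hs⟩ => by
      have h0 : s = 0 := Fin.ext (by omega)
      subst h0
      exact hs
  | l + 1, a, ⟨s, hs⟩ => by
      induction s using Fin.lastCases with
      | last => simp [iterComm, rightComm, hs]
      | cast s =>
        have := iterComm_eq_one l (fun s => a s.castSucc) ⟨s, hs⟩
        simp [iterComm, rightComm, this]

/-- The defining relators of the Cohen group on `n` generators:
`[[x_{i₀}, …, x_{i_l}]` whenever two of the indices agree, and
`[[x_{i₀}^{m₀}, …, x_{i_l}^{m_l}] = [[x_{i₀}, …, x_{i_l}]^{m₀ ⋯ m_l}`. -/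
def cohenRels (n : ℕ) : Set (FreeGroup (Fin n)) :=
  {r | ∃ (l : ℕ) (i : Fin (l + 1) → Fin n), (∃ s t, s < t ∧ i s = i t) ∧
      r = iterComm l fun s => FreeGroup.of (i s)} ∪
  {r | ∃ (l : ℕ) (i : Fin (l + 1) → Fin n) (m : Fin (l + 1) → ℤ),
      r = (iterComm l fun s => FreeGroup.of (i s) ^ m s) *
        ((iterComm l fun s => FreeGroup.of (i s)) ^ ∏ s, m s)⁻¹}

/-- The Cohen group `K_n`. -/
abbrev CohenK (n : ℕ) : Type := PresentedGroup (cohenRels n)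

/-- The generator `x_i` of `K_n`. -/
def CohenK.x {n : ℕ} (i : Fin n) : CohenK n := PresentedGroup.of i

theorem CohenK.rel_one {n : ℕ} (l : ℕ) (i : Fin (l + 1) → Fin n) (h : ∃ s t, s < t ∧ i s = i t) :
    (iterComm l fun s => CohenK.x (i s)) = 1 := by
  have h1 := PresentedGroup.one_of_mem (rels := cohenRels n)
    (x := iterComm l fun s => FreeGroup.of (i s)) (Or.inl ⟨l, i, h, rfl⟩)
  rw [map_iterComm] at h1
  exact h1

theorem CohenK.rel_pow {n : ℕ} (l : ℕ) (i : Fin (l + 1) → Fin n) (m : Fin (l + 1) → ℤ) :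
    (iterComm l fun s => CohenK.x (i s) ^ m s) = (iterComm l fun s => CohenK.x (i s)) ^ ∏ s, m s := by
  have h1 := PresentedGroup.one_of_mem (rels := cohenRels n)
    (x := (iterComm l fun s => FreeGroup.of (i s) ^ m s) *
        ((iterComm l fun s => FreeGroup.of (i s)) ^ ∏ s, m s)⁻¹) (Or.inr ⟨l, i, m, rfl⟩)
  rw [map_mul, map_inv, map_zpow, map_iterComm, map_iterComm, mul_inv_eq_one] at h1
  simp only [map_zpow] at h1
  exact h1

/-- The assignment on generators of the `j`-th projection: `x_j ↦ 1`, and the remaining generators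
of `K_{n+1}` are sent in order to those of `K_n`. -/
def CohenK.dGen {n : ℕ} (j : Fin (n + 1)) : Fin (n + 1) → CohenK n :=
  Fin.insertNth (α := fun _ => CohenK n) j 1 CohenK.x

theorem CohenK.dGen_cases {n : ℕ} (j : Fin (n + 1)) {ι : Type*} (i : ι → Fin (n + 1)) :
    (∃ s, dGen j (i s) = 1) ∨
      ∃ i' : ι → Fin n, (∀ s, i s = j.succAbove (i' s)) ∧ ∀ s, dGen j (i s) = x (i' s) := by
  by_cases h : ∃ s, i s = j
  · obtain ⟨s, hs⟩ := h
    exact Or.inl ⟨s, by simp [dGen, hs]⟩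
  · push Not at h
    choose i' hi' using fun s => Fin.exists_succAbove_eq (h s)
    refine Or.inr ⟨i', fun s => (hi' s).symm, fun s => ?_⟩
    rw [← hi' s, dGen, Fin.insertNth_apply_succAbove]

/-- The projection `d_j : K_{n+1} → K_n`. -/
def CohenK.d {n : ℕ} (j : Fin (n + 1)) : CohenK (n + 1) →* CohenK n :=
  PresentedGroup.toGroup (f := dGen j) (by
    rintro r (⟨l, i, ⟨s, t, hst, hi⟩, rfl⟩ | ⟨l, i, m, rfl⟩)
    · rw [map_iterComm]
      simp only [FreeGroup.lift_apply_of]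
      rcases dGen_cases j i with h | ⟨i', h1, h2⟩
      · exact iterComm_eq_one l _ h
      · simp only [h2]
        refine rel_one l i' ⟨s, t, hst, ?_⟩
        rw [h1 s, h1 t] at hi
        exact Fin.succAbove_right_injective hi
    · rw [map_mul, map_inv, map_zpow, map_iterComm, map_iterComm, mul_inv_eq_one]
      simp only [map_zpow, FreeGroup.lift_apply_of]
      rcases dGen_cases j i with h | ⟨i', h1, h2⟩
      · rw [iterComm_eq_one l _ h, one_zpow]
        obtain ⟨s, hs⟩ := h
        exact iterComm_eq_one l _ ⟨s, by rw [hs, one_zpow]⟩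
      · simp only [h2]
        exact rel_pow l i' m)

/-- The combinatorial group `H_n`: the equalizer of the projections `d_j : K_n → K_{n-1}`
(for `n = 0` there are no projections). -/
def cohenH : (n : ℕ) → Subgroup (CohenK n)
  | 0 => ⊤
  | _ + 1 => ⨅ i, ⨅ j, (CohenK.d i).eqLocus (CohenK.d j)

end Combinatorial

/-! ### Compactly generated spaces -/

section CG

/-- The `n`-fold cartesian power of `X` in compactly generated spaces: the set `X^n` with the
compactly generated refinement of the product topology. -/
def CGPow (X : Type u) (n : ℕ) : Type u := Fin n → X

variable {X : Type u} [TopologicalSpace X]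

instance CGPow.instTopologicalSpace (n : ℕ) : TopologicalSpace (CGPow X n) :=
  TopologicalSpace.compactlyGenerated.{u} (Fin n → X)

/-- The underlying tuple of a point of the power. -/
def CGPow.toPi {n : ℕ} (x : CGPow X n) : Fin n → X := x

theorem CGPow.continuous_toPi (n : ℕ) : Continuous (CGPow.toPi : CGPow X n → Fin n → X) :=
  continuous_from_compactlyGenerated.{u} (X := Fin n → X) (fun x => x) fun _ g => g.continuous

theorem CGPow.continuous_apply {n : ℕ} (i : Fin n) : Continuous (fun x : CGPow X n => x i) :=
  (_root_.continuous_apply (A := fun _ : Fin n => X) i).comp (CGPow.continuous_toPi n)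

theorem CGPow.continuous_of_compHaus {n : ℕ} (K : CompHaus.{u}) (f : K → CGPow X n)
    (hf : ∀ i, Continuous fun k => f k i) : Continuous f := by
  have hf' : Continuous (fun k => (f k).toPi) := continuous_pi hf
  refine continuous_def.2 fun U hU => ?_
  have hU' := isOpen_sigma_iff.1 (isOpen_coinduced.1 hU)
  exact hU' ⟨K, ⟨_, hf'⟩⟩

instance CGPow.instCompactlyGenerated (n : ℕ) : CompactlyGeneratedSpace (CGPow X n) :=
  uCompactlyGeneratedSpace_of_continuous_maps fun f h => by
    refine continuous_from_compactlyGenerated.{u} (X := Fin n → X) f fun S g => ?_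
    exact h S ⟨fun k => g k, continuous_of_compHaus S (fun k => g k)
      fun i => (_root_.continuous_apply i).comp g.continuous⟩

/-- A map from a compactly generated space to the power is continuous as soon as its coordinates
are. -/
theorem CGPow.continuous_of_apply {Z : Type u} [TopologicalSpace Z] [CompactlyGeneratedSpace Z]
    {n : ℕ} (f : Z → CGPow X n) (hf : ∀ i, Continuous fun z => f z i) : Continuous f :=
  continuous_from_uCompactlyGeneratedSpace f fun S g =>
    continuous_of_compHaus S _ fun i => (hf i).comp g.continuous

end CG

/-! ### Pointed homotopy classes -/

section HoClass

/-- Continuous pointed maps `(Z, z₀) → (Y, y₀)`. -/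
def PMap {Z Y : Type u} [TopologicalSpace Z] [TopologicalSpace Y] (z₀ : Z) (y₀ : Y) : Type u :=
  {f : C(Z, Y) // f z₀ = y₀}

/-- Pointed homotopy of pointed maps. -/
def PMap.setoid {Z Y : Type u} [TopologicalSpace Z] [TopologicalSpace Y] (z₀ : Z) (y₀ : Y) :
    Setoid (PMap z₀ y₀) where
  r f g := f.1.HomotopicRel g.1 {z₀}
  iseqv := ⟨fun _ => .refl _, fun h => h.symm, fun h k => h.trans k⟩

/-- The set `[Z, Y]` of pointed homotopy classes of pointed maps `(Z, z₀) → (Y, y₀)`. -/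
def HoClass {Z Y : Type u} [TopologicalSpace Z] [TopologicalSpace Y] (z₀ : Z) (y₀ : Y) : Type u :=
  Quotient (PMap.setoid z₀ y₀)

/-- The homotopy class of a pointed map. -/
def HoClass.mk {Z Y : Type u} [TopologicalSpace Z] [TopologicalSpace Y] {z₀ : Z} {y₀ : Y}
    (f : C(Z, Y)) (hf : f z₀ = y₀) : HoClass z₀ y₀ :=
  Quotient.mk (PMap.setoid z₀ y₀) ⟨f, hf⟩

/-- The base point of `X` is non-degenerate: `(X, x₀)` is an NDR pair. -/
def NondegenerateBasepoint {X : Type u} [TopologicalSpace X] (x₀ : X) : Prop :=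
  ∃ (v : C(X, unitInterval)) (h : C(unitInterval × X, X)),
    (∀ x, v x = 0 ↔ x = x₀) ∧ (∀ x, h (0, x) = x) ∧ (∀ t, h (t, x₀) = x₀) ∧
      ∀ x, v x < 1 → h (1, x) = x₀

/-- `X` has the homotopy type of a CW complex. -/
def HasCWHomotopyType (X : Type u) [TopologicalSpace X] : Prop :=
  ∃ Y : TopCat.{u}, Nonempty (TopCat.CWComplex Y) ∧ Nonempty (ContinuousMap.HomotopyEquiv X Y)

end HoClass

/-! ### Smash powers and weak Lusternik–Schnirelmann category -/

section Smash

variable {X : Type u} [TopologicalSpace X]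

/-- The relation on `X^k` identifying all points having some coordinate equal to the base
point. -/
def smashRel (x₀ : X) (k : ℕ) (a b : CGPow X k) : Prop :=
  (∃ i, a i = x₀) ∧ ∃ j, b j = x₀

/-- The `k`-fold smash power `X^{(k)}`, for `k ≥ 1`. -/
def SmashPow (x₀ : X) (k : ℕ) : Type u := Quot (smashRel x₀ k)

instance (x₀ : X) (k : ℕ) : TopologicalSpace (SmashPow x₀ k) :=
  inferInstanceAs (TopologicalSpace (Quot (smashRel x₀ k)))

/-- The base point of the smash power. -/
def SmashPow.base (x₀ : X) (k : ℕ) : SmashPow x₀ k := Quot.mk _ (fun _ => x₀ : CGPow X k)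

/-- The reduced diagonal `X → X^{(k)}`. -/
def reducedDiagonal [CompactlyGeneratedSpace X] (x₀ : X) (k : ℕ) : C(X, SmashPow x₀ k) where
  toFun x := Quot.mk _ (fun _ => x : CGPow X k)
  continuous_toFun := continuous_quot_mk.comp
    (CGPow.continuous_of_apply (fun x => (fun _ => x : CGPow X k)) fun _ => continuous_id)

/-- `X` has weak LS-category less than `k` if the reduced diagonal `X → X^{(k)}` is (pointed) null
homotopic. -/
def WeakLSCatLT [CompactlyGeneratedSpace X] (x₀ : X) (k : ℕ) : Prop :=
  (reducedDiagonal x₀ k).HomotopicRel (ContinuousMap.const X (SmashPow.base x₀ k)) {x₀}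

end Smash

/-! ### The James construction -/

section James

variable {X : Type u}

/-- The James construction `J(X)`: the free monoid on `X` modulo the single relation that the
base point is the unit. -/
def James (x₀ : X) : Type u :=
  (conGen fun a b : FreeMonoid X => a = FreeMonoid.of x₀ ∧ b = 1).Quotient

variable {x₀ : X}

instance : Monoid (James x₀) :=
  inferInstanceAs (Monoid
    (conGen fun a b : FreeMonoid X => a = FreeMonoid.of x₀ ∧ b = 1).Quotient)

/-- The canonical map `E : X → J(X)` on underlying sets. -/
def James.of (x₀ : X) (x : X) : James x₀ :=
  (conGen fun a b : FreeMonoid X => a = FreeMonoid.of x₀ ∧ b = 1).mk' (FreeMonoid.of x)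

theorem James.of_base : James.of x₀ x₀ = 1 :=
  (Con.eq _).2 (ConGen.Rel.of _ _ ⟨rfl, rfl⟩)

/-- The word `x₁ x₂ ⋯ x_k` in `J(X)`. -/
def James.word (x₀ : X) (p : Σ k, CGPow X k) : James x₀ :=
  (List.ofFn fun i => James.of x₀ (p.2 i)).prod

/-- Concatenation of tuples. -/
def CGPow.append {k l : ℕ} (a : CGPow X k) (b : CGPow X l) : CGPow X (k + l) :=
  Fin.append (α := X) a b

theorem CGPow.append_left {k l : ℕ} (a : CGPow X k) (b : CGPow X l) (i : Fin k) :
    CGPow.append a b (Fin.castAdd l i) = a i := Fin.append_left (α := X) a b i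

theorem CGPow.append_right {k l : ℕ} (a : CGPow X k) (b : CGPow X l) (i : Fin l) :
    CGPow.append a b (Fin.natAdd k i) = b i := Fin.append_right (α := X) a b i

theorem James.word_surjective : Function.Surjective (James.word x₀) := by
  intro w
  obtain ⟨l, rfl⟩ := Con.mk'_surjective w
  refine ⟨⟨(FreeMonoid.toList l).length, fun i => (FreeMonoid.toList l).get i⟩, ?_⟩
  have h : (fun i => James.of x₀ ((FreeMonoid.toList l).get i)) =
      James.of x₀ ∘ (FreeMonoid.toList l).get := rfl
  unfold James.word
  rw [h, ← List.map_ofFn, List.ofFn_get]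
  induction l using FreeMonoid.inductionOn' with
  | one => rfl
  | of_mul x l ih =>
    rw [FreeMonoid.toList_of_mul, List.map_cons, List.prod_cons, ih rfl]
    rfl

theorem James.word_append {k l : ℕ} (a : CGPow X k) (b : CGPow X l) :
    James.word x₀ ⟨k + l, CGPow.append a b⟩ =
      James.word x₀ ⟨k, a⟩ * James.word x₀ ⟨l, b⟩ := by
  have h : (fun i => James.of x₀ (CGPow.append a b i)) =
      Fin.append (fun i => James.of x₀ (a i)) (fun i => James.of x₀ (b i)) := by
    funext i
    refine Fin.addCases (fun i => ?_) (fun i => ?_) i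
    · rw [CGPow.append_left, Fin.append_left]
    · rw [CGPow.append_right, Fin.append_right]
  unfold James.word
  rw [h, List.ofFn_fin_append, List.prod_append]

variable [TopologicalSpace X]

/-- `J(X)` has the quotient topology from the disjoint union of the powers `X^k`. -/
instance : TopologicalSpace (James x₀) :=
  TopologicalSpace.coinduced (James.word x₀) inferInstance

theorem James.continuous_word : Continuous (James.word x₀) := continuous_coinduced_rng

theorem James.continuous_word_mul_word (K L : CompHaus.{u}) {k l : ℕ} (a : C(K, CGPow X k))
    (b : C(L, CGPow X l)) :
    Continuous fun p : K × L => James.word x₀ ⟨k, a p.1⟩ * James.word x₀ ⟨l, b p.2⟩ := by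
  simp only [← James.word_append]
  refine James.continuous_word.comp (continuous_sigmaMk.comp
    (CGPow.continuous_of_compHaus (CompHaus.of (K × L)) _ fun i => ?_))
  refine Fin.addCases (fun i => ?_) (fun i => ?_) i
  · simp only [CGPow.append_left]
    exact (CGPow.continuous_apply i).comp (a.continuous.comp continuous_fst)
  · simp only [CGPow.append_right]
    exact (CGPow.continuous_apply i).comp (b.continuous.comp continuous_snd)

theorem locallyCompactSpace_of_compact_t2 (K : Type u) [TopologicalSpace K] [CompactSpace K]
    [T2Space K] : LocallyCompactSpace K := inferInstance

/-- A family of self-maps of `J(X)` parametrised by a compact space is jointly continuous as soon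
as it is so on all compact families of words. -/
theorem James.continuous_uncurry (K : CompHaus.{u}) (F : K → James x₀ → James x₀)
    (h : ∀ (l : ℕ) (L : CompHaus.{u}) (b : C(L, CGPow X l)),
      Continuous fun p : L × K => F p.2 (James.word x₀ ⟨l, b p.1⟩)) :
    Continuous fun p : James x₀ × K => F p.2 p.1 := by
  have hs : ∀ w : James x₀, Continuous fun c : K => F c w := by
    intro w
    obtain ⟨⟨l, y⟩, rfl⟩ := James.word_surjective w
    exact (h l (CompHaus.of PUnit) (ContinuousMap.const _ y)).comp
      (Continuous.prodMk_right PUnit.unit)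
  let G : James x₀ → C(K, James x₀) := fun w => ⟨_, hs w⟩
  have hG : Continuous G := by
    refine continuous_coinduced_dom.2 (continuous_sigma fun l => ?_)
    refine continuous_from_uCompactlyGeneratedSpace _ fun S q => ?_
    exact ContinuousMap.continuous_of_continuous_uncurry _ (h l S q)
  have : LocallyCompactSpace K := locallyCompactSpace_of_compact_t2 K
  exact ContinuousMap.continuous_uncurry_of_continuous ⟨G, hG⟩

/-- The multiplication of `J(X)` is continuous on compact Hausdorff test spaces. -/
theorem James.continuous_mul_compHaus (K : CompHaus.{u}) (f g : C(K, James x₀)) :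
    Continuous fun κ => f κ * g κ := by
  have A : ∀ (L : CompHaus.{u}) (k : ℕ) (h : C(L, CGPow X k)),
      Continuous fun p : James x₀ × L => James.word x₀ ⟨k, h p.2⟩ * p.1 := fun L k h =>
    James.continuous_uncurry L (fun c w => James.word x₀ ⟨k, h c⟩ * w) fun l M b =>
      (James.continuous_word_mul_word L M h b).comp continuous_swap
  have B : Continuous fun p : James x₀ × K => p.1 * g p.2 :=
    James.continuous_uncurry K (fun c w => w * g c) fun l L b =>
      (A L l b).comp ((g.continuous.comp continuous_snd).prodMk continuous_fst)
  exact B.comp (f.continuous.prodMk continuous_id)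

/-- The pointwise product of maps from a compactly generated space to `J(X)`. -/
def James.mulMap {Z : Type u} [TopologicalSpace Z] [CompactlyGeneratedSpace Z]
    (f g : C(Z, James x₀)) : C(Z, James x₀) where
  toFun z := f z * g z
  continuous_toFun := continuous_from_uCompactlyGeneratedSpace _ fun S q =>
    James.continuous_mul_compHaus S (f.comp q) (g.comp q)

theorem James.mulMap_homotopicRel {Z : Type u} [TopologicalSpace Z] [CompactlyGeneratedSpace Z]
    {f f' g g' : C(Z, James x₀)} {S : Set Z} (hf : f.HomotopicRel f' S)
    (hg : g.HomotopicRel g' S) : (mulMap f g).HomotopicRel (mulMap f' g') S := by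
  obtain ⟨F⟩ := hf
  obtain ⟨G⟩ := hg
  have hc : Continuous fun p : unitInterval × Z => F p * G p := by
    let Φ : Z → C(unitInterval, James x₀) := fun z =>
      ⟨fun t => F (t, z) * G (t, z), by
        have := James.continuous_mul_compHaus (CompHaus.of (ULift.{u} unitInterval))
          ⟨fun t => F (t.down, z), by fun_prop⟩ ⟨fun t => G (t.down, z), by fun_prop⟩
        exact this.comp continuous_uliftUp⟩
    have hΦ : Continuous Φ := by
      refine continuous_from_uCompactlyGeneratedSpace _ fun S q => ?_
      refine ContinuousMap.continuous_of_continuous_uncurry _ ?_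
      exact James.continuous_mul_compHaus (CompHaus.of (S × unitInterval))
        ⟨fun p => F (p.2, q p.1), by fun_prop⟩ ⟨fun p => G (p.2, q p.1), by fun_prop⟩
    exact (ContinuousMap.continuous_uncurry_of_continuous ⟨Φ, hΦ⟩).comp continuous_swap
  exact ⟨{ toFun := fun p => F p * G p
           continuous_toFun := hc
           map_zero_left := fun z => by simp [mulMap]
           map_one_left := fun z => by simp [mulMap]
           prop' := fun t z hz => by
            change F (t, z) * G (t, z) = f z * g z
            rw [F.eq_fst t hz, G.eq_fst t hz] }⟩

/-- The multiplication of homotopy classes of maps to `J(X)`, induced by the multiplication of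
`J(X)`. -/
instance {Z : Type u} [TopologicalSpace Z] [CompactlyGeneratedSpace Z] (z₀ : Z) :
    Monoid (HoClass z₀ (1 : James x₀)) where
  mul := Quotient.map₂
    (fun f g => ⟨James.mulMap f.1 g.1, by simp [James.mulMap, f.2, g.2]⟩)
    (fun _ _ hf _ _ hg => James.mulMap_homotopicRel hf hg)
  one := HoClass.mk (ContinuousMap.const Z 1) rfl
  mul_assoc := by
    rintro ⟨f⟩ ⟨g⟩ ⟨h⟩
    exact congrArg (Quotient.mk _) (Subtype.ext (ContinuousMap.ext fun z => mul_assoc _ _ _))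
  one_mul := by
    rintro ⟨f⟩
    exact congrArg (Quotient.mk _) (Subtype.ext (ContinuousMap.ext fun z => one_mul _))
  mul_one := by
    rintro ⟨f⟩
    exact congrArg (Quotient.mk _) (Subtype.ext (ContinuousMap.ext fun z => mul_one _))

/-- The homomorphism `q^* : [Y, J(X)] → [Z, J(X)]` induced by a pointed map `q : Z → Y`. -/
def HoClass.precomp {Z Y : Type u} [TopologicalSpace Z] [CompactlyGeneratedSpace Z]
    [TopologicalSpace Y] [CompactlyGeneratedSpace Y] {z₀ : Z} {y₀ : Y} (q : C(Z, Y))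
    (hq : q z₀ = y₀) : HoClass y₀ (1 : James x₀) →* HoClass z₀ (1 : James x₀) where
  toFun := Quotient.map (fun f => ⟨f.1.comp q, by simp [hq, f.2]⟩) (by
    rintro ⟨f, hf⟩ ⟨g, hg⟩ ⟨H⟩
    exact ⟨{ toFun := fun p => H (p.1, q p.2)
             continuous_toFun := by fun_prop
             map_zero_left := fun z => by simp
             map_one_left := fun z => by simp
             prop' := fun t z hz => by
              rw [Set.mem_singleton_iff] at hz
              subst hz
              exact H.eq_fst t hq }⟩)
  map_one' := rfl
  map_mul' := by
    rintro ⟨f⟩ ⟨g⟩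
    rfl

/-- The continuous map `E : X → J(X)`. -/
def James.E [CompactlyGeneratedSpace X] (x₀ : X) : C(X, James x₀) where
  toFun := James.of x₀
  continuous_toFun := by
    have h : James.of x₀ = fun x => James.word x₀ ⟨1, (fun _ => x : Fin 1 → X)⟩ := by
      funext x
      simp [James.word]
    rw [h]
    exact James.continuous_word.comp (continuous_sigmaMk.comp
      (CGPow.continuous_of_apply (fun x => (fun _ => x : CGPow X 1)) fun _ => continuous_id))

/-! ### The James filtration -/

/-- The base point of `X^n`. -/
def CGPow.base (x₀ : X) (n : ℕ) : CGPow X n := fun _ => x₀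

/-- The inclusion `i_j : X^n → X^{n+1}` inserting the base point in the `j`-th place. -/
def CGPow.incl (x₀ : X) {n : ℕ} (j : Fin (n + 1)) (y : CGPow X n) : CGPow X (n + 1) :=
  Fin.insertNth (α := fun _ => X) j x₀ y

/-- The relation on `X^n` identifying `i_j(y)` and `i_k(y)` for all `y ∈ X^{n-1}` and all
`j`, `k`. -/
inductive jamesFilRel (x₀ : X) : (n : ℕ) → CGPow X n → CGPow X n → Prop
  | move {n : ℕ} (j k : Fin (n + 1)) (y : CGPow X n) :
      jamesFilRel x₀ (n + 1) (CGPow.incl x₀ j y) (CGPow.incl x₀ k y)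

/-- The `n`-th stage `J_n(X)` of the James filtration: the coequalizer of the inclusions
`i_j : X^{n-1} → X^n`. -/
def JamesFil (x₀ : X) (n : ℕ) : Type u := Quot (jamesFilRel x₀ n)

instance (n : ℕ) : TopologicalSpace (JamesFil x₀ n) :=
  inferInstanceAs (TopologicalSpace (Quot (jamesFilRel x₀ n)))

/-- The quotient map `q_n : X^n → J_n(X)`. -/
def JamesFil.q (x₀ : X) (n : ℕ) : C(CGPow X n, JamesFil x₀ n) where
  toFun := Quot.mk _
  continuous_toFun := continuous_quot_mk

instance (n : ℕ) : CompactlyGeneratedSpace (JamesFil x₀ n) :=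
  uCompactlyGeneratedSpace_of_coinduced (JamesFil.q x₀ n).continuous rfl

/-- The base point of `J_n(X)`. -/
def JamesFil.base (x₀ : X) (n : ℕ) : JamesFil x₀ n := JamesFil.q x₀ n (CGPow.base x₀ n)

/-- The homomorphism `q_n^* : [J_n(X), J(X)] → [X^n, J(X)]`. -/
def qStar (x₀ : X) (n : ℕ) : HoClass (JamesFil.base x₀ n) (1 : James x₀) →*
    HoClass (CGPow.base x₀ n) (1 : James x₀) :=
  HoClass.precomp (JamesFil.q x₀ n) rfl

/-! ### The geometric groups -/

/-- The class `x_i ∈ [X^n, J(X)]` of the composite `X^n → X → J(X)` of the `i`-th coordinate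
projection and `E`. -/
def xClass [CompactlyGeneratedSpace X] (x₀ : X) {n : ℕ} (i : Fin n) : HoClass (CGPow.base x₀ n) (1 : James x₀) :=
  HoClass.mk ((James.E x₀).comp ⟨fun x => x i, CGPow.continuous_apply i⟩) James.of_base

/-- `K_n(X)`: the subgroup of (invertible elements of) `[X^n, J(X)]` generated by the `x_i`. -/
def geomK [CompactlyGeneratedSpace X] (x₀ : X) (n : ℕ) : Submonoid (HoClass (CGPow.base x₀ n) (1 : James x₀)) :=
  (Subgroup.closure {a : (HoClass (CGPow.base x₀ n) (1 : James x₀))ˣ |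
    ∃ i, (a : HoClass (CGPow.base x₀ n) (1 : James x₀)) = xClass x₀ i}).toSubmonoid.map
      (Units.coeHom _)

/-- `H_n(X) = [J_n(X), J(X)] ∩ K_n(X)`: the classes in `[J_n(X), J(X)]` whose image under `q_n^*`
lies in `K_n(X)`. -/
def geomH [CompactlyGeneratedSpace X] (x₀ : X) (n : ℕ) : Submonoid (HoClass (JamesFil.base x₀ n) (1 : James x₀)) :=
  (geomK x₀ n).comap (qStar x₀ n)

end James

/-! Three ingredients carry the theorem: inverses in the classes of maps to J(X), the Cohen
relations among the `x_i`, and the identification of [J_n(X), J(X)] with the equalizer of the faces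
of [X^n, J(X)].

Inverses. J(X) is path connected, so its right translations are homotopic to the identity and their
homotopy fibres are weakly contractible. Hence left inverses up to a path can be extended over
cells, which yields g with g · E null homotopic (`James.exists_leftInverse_E`). Extending g to an
antihomomorphism χ of J(X) and cancelling letter by letter from the middle of χ(w) w gives a pointed
homotopy from χ(w) w to 1 (`James.exists_leftInverse`). Composition with χ then inverts every class.

Relations. In [X^{l+1}, J(X)] the iterated commutator of all l + 1 coordinates vanishes on every
face, so a representative is trivial on the fat wedge (`exists_trivial_on_fatWedge`). A commutator
with a repeated index is its pullback along a map duplicating a coordinate; the duplicated pair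
enters through X → X ∧ X, which is null homotopic (`homotopicRel_one_of_weakLSCatLT`). The relations
on powers are a formal consequence of these vanishing commutators (`iterComm_zpow`). So K_n is
represented in the units of [X^n, J(X)], compatibly with faces (`cohenRep`, `face_cohenRep`).

Descent. A map X^k → J(X) trivial on the fat wedge extends over J_n(X) by multiplying its values
over all subwords of length k (`hopMap`). Correcting by such extensions one word length at a time
shows that q_n^* is injective (`qStar_injective`) and, for n > 0, that its image contains every
class whose faces agree (`exists_qStar_eq`). Thus the image of the combinatorial H_n lifts, and
uniqueness of the lifts makes lifting multiplicative. -/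

/-! ### Commutator calculus: vanishing of repeated commutators implies multiplicativity in powers -/

section CommutatorCalculus

variable {G : Type*} [Group G]

/-- A set of left-normed commutators in the family `x` starting with `x i`. -/
def leftNormedFrom {n : ℕ} (x : Fin n → G) (i : Fin n) : Set G :=
  {g | ∃ (l : ℕ) (c : Fin (l + 1) → Fin n), c 0 = i ∧ g = iterComm l fun s => x (c s)}

theorem iterComm_snoc {n : ℕ} (x : Fin n → G) {l : ℕ} (c : Fin (l + 1) → Fin n) (j : Fin n) :
    (iterComm (l + 1) fun s => x ((Fin.snoc c j : Fin (l + 2) → Fin n) s)) =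
      rightComm (iterComm l fun s => x (c s)) (x j) := by
  simp [iterComm]

variable {n : ℕ} {x : Fin n → G}

theorem leftNormedFrom_step {i : Fin n} {g : G} (hg : g ∈ leftNormedFrom x i) (j : Fin n) :
    rightComm g (x j) ∈ leftNormedFrom x i := by
  obtain ⟨l, c, hc, rfl⟩ := hg
  refine ⟨l + 1, Fin.snoc c j, ?_, (iterComm_snoc x c j).symm⟩
  rw [← hc, ← Fin.castSucc_zero, Fin.snoc_castSucc]

theorem leftNormedFrom_induction {i : Fin n} {p : G → Prop} (h0 : p (x i))
    (h1 : ∀ g ∈ leftNormedFrom x i, p g → ∀ j, p (rightComm g (x j))) :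
    ∀ g ∈ leftNormedFrom x i, p g := by
  rintro g ⟨l, c, hc, rfl⟩
  induction l with
  | zero => simpa [iterComm, hc] using h0
  | succ l ih =>
    have := ih (fun s => c s.castSucc) (by simpa using hc)
    exact h1 _ ⟨l, _, by simpa using hc, rfl⟩ this (c (Fin.last _))

theorem rightComm_eq_one_iff {a b : G} : rightComm a b = 1 ↔ Commute a b := by
  unfold rightComm
  rw [mul_assoc, ← mul_inv_rev, inv_mul_eq_one]
  exact ⟨fun h => h.symm, fun h => h.symm⟩

theorem mul_rightComm (a b : G) : a * rightComm a b = b⁻¹ * a * b := by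
  simp [rightComm, mul_assoc]

variable (hx : ∀ (l : ℕ) (c : Fin (l + 1) → Fin n), (∃ s t, s < t ∧ c s = c t) →
  (iterComm l fun s => x (c s)) = 1)

include hx

/-- Appending `x j` twice produces a repeated index, so `hx` gives [[g, x_j], x_j] = 1. -/
theorem commute_rightComm_of_mem {i : Fin n} {g : G} (hg : g ∈ leftNormedFrom x i) (j : Fin n) :
    Commute (rightComm g (x j)) (x j) := by
  obtain ⟨l, c, -, rfl⟩ := hg
  rw [← rightComm_eq_one_iff, ← iterComm_snoc, ← iterComm_snoc]
  refine hx _ _ ⟨(Fin.last _).castSucc, Fin.last _, Fin.castSucc_lt_last _, ?_⟩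
  rw [Fin.snoc_castSucc, Fin.snoc_last, Fin.snoc_last]

/-- As x_j commutes with [g, x_j], conjugating a generator g by x_j in either direction gives g [g,
x_j]^{±1}. Hence every x_j normalizes this subgroup. -/
theorem conj_mem_closure (i j : Fin n) {g : G} (hg : g ∈ Subgroup.closure (leftNormedFrom x i)) :
    (x j)⁻¹ * g * x j ∈ Subgroup.closure (leftNormedFrom x i) ∧
      x j * g * (x j)⁻¹ ∈ Subgroup.closure (leftNormedFrom x i) := by
  induction hg using Subgroup.closure_induction with
  | mem g hg =>
    have h1 := Subgroup.subset_closure (leftNormedFrom_step hg j)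
    refine ⟨?_, ?_⟩
    · rw [← mul_rightComm]
      exact mul_mem (Subgroup.subset_closure hg) h1
    · have h2 : x j * g * (x j)⁻¹ = g * (rightComm g (x j))⁻¹ := by
        have h3 := mul_rightComm g (x j)
        have h4 := (commute_rightComm_of_mem hx hg j).eq
        have h5 : g = x j * (g * rightComm g (x j)) * (x j)⁻¹ := by rw [h3]; group
        have h6 : x j * (g * rightComm g (x j)) * (x j)⁻¹ =
            x j * g * (x j)⁻¹ * rightComm g (x j) := by
          rw [mul_assoc, mul_assoc g, ← (commute_rightComm_of_mem hx hg j).inv_right.symm.eq]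
          group
        rw [eq_mul_inv_iff_mul_eq, ← h6, ← h5]
      rw [h2]
      exact mul_mem (Subgroup.subset_closure hg) (inv_mem h1)
  | one => simp [one_mem]
  | mul a b _ _ ha hb =>
    refine ⟨?_, ?_⟩
    · convert mul_mem ha.1 hb.1 using 1; group
    · convert mul_mem ha.2 hb.2 using 1; group
  | inv a _ ha =>
    refine ⟨?_, ?_⟩
    · convert inv_mem ha.1 using 1; group
    · convert inv_mem ha.2 using 1; group

/-- The commutator [h, x_i] repeats the index i, so x_i centralizes the subgroup generated by these
commutators. Since each x_j normalizes that subgroup, its centralizer is stable under conjugation by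
x_j, hence under g ↦ [g, x_j] = g⁻¹ · (x_j⁻¹ g x_j). -/
theorem commute_of_mem_leftNormedFrom {i : Fin n} {g h : G} (hg : g ∈ leftNormedFrom x i)
    (hh : h ∈ leftNormedFrom x i) : Commute g h := by
  suffices H : ∀ g ∈ leftNormedFrom x i, ∀ h ∈ Subgroup.closure (leftNormedFrom x i),
      Commute g h from H g hg h (Subgroup.subset_closure hh)
  clear hg hh g h
  refine leftNormedFrom_induction ?_ ?_
  · intro h hh
    induction hh using Subgroup.closure_induction with
    | mem h hh =>
      obtain ⟨l, c, hc, rfl⟩ := hh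
      refine (rightComm_eq_one_iff.1 ?_).symm
      rw [← iterComm_snoc]
      refine hx _ _ ⟨(0 : Fin (l + 1)).castSucc, Fin.last _, Fin.castSucc_lt_last _, ?_⟩
      rw [Fin.snoc_castSucc, Fin.snoc_last, hc]
    | one => exact Commute.one_right _
    | mul a b _ _ ha hb => exact ha.mul_right hb
    | inv a _ ha => exact ha.inv_right
  · intro g hg ih j h hh
    have h1 : Commute ((x j)⁻¹ * g * x j) h := by
      have h2 := ih _ (conj_mem_closure hx i j hh).2
      have h3 := congrArg (fun z => (x j)⁻¹ * z * x j) h2.eq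
      simp only [mul_assoc, inv_mul_cancel, mul_one, inv_mul_cancel_left] at h3
      simpa [Commute, SemiconjBy, mul_assoc] using h3
    have h4 : rightComm g (x j) = g⁻¹ * ((x j)⁻¹ * g * x j) := by simp [rightComm, mul_assoc]
    rw [h4]
    exact (ih h hh).inv_left.mul_left h1

/-- If all left-normed commutators with a repeated entry vanish, then left-normed commutators are
multiplicative in powers of their entries. -/
theorem iterComm_zpow (l : ℕ) (c : Fin (l + 1) → Fin n) (m : Fin (l + 1) → ℤ) :
    (iterComm l fun s => x (c s) ^ m s) = (iterComm l fun s => x (c s)) ^ ∏ s, m s := by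
  induction l with
  | zero => simp [iterComm]
  | succ l ih =>
    have ih := ih (fun s => c s.castSucc) fun s => m s.castSucc
    rw [Fin.prod_univ_castSucc]
    simp only [iterComm]
    rw [ih]
    generalize (∏ s : Fin (l + 1), m s.castSucc) = M
    generalize m (Fin.last (l + 1)) = k
    generalize hj : c (Fin.last (l + 1)) = j
    have ha : (iterComm l fun s => x (c s.castSucc)) ∈ leftNormedFrom x (c 0) :=
      ⟨l, _, by simp, rfl⟩
    generalize (iterComm l fun s => x (c s.castSucc)) = a at ha
    have h1 := leftNormedFrom_step ha j
    have h2 := commute_rightComm_of_mem hx ha j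
    have h3 := commute_of_mem_leftNormedFrom hx ha h1
    have h4 : ∀ k : ℤ, (x j ^ k)⁻¹ * a * x j ^ k = a * rightComm a (x j) ^ k := by
      have h6 := mul_rightComm a (x j)
      intro k
      induction k using Int.induction_on with
      | zero => simp
      | succ k ihk =>
        rw [zpow_add_one, zpow_add_one]
        calc _ = (x j)⁻¹ * ((x j ^ (k : ℤ))⁻¹ * a * x j ^ (k : ℤ)) * x j := by group
          _ = ((x j)⁻¹ * a * x j) * ((x j)⁻¹ * rightComm a (x j) ^ (k : ℤ) * x j) := by
            rw [ihk]; group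
          _ = _ := by
            rw [← h6, mul_assoc (x j)⁻¹, (h2.zpow_left k).eq, inv_mul_cancel_left, mul_assoc,
              ← zpow_one_add, ← zpow_add_one, add_comm]
      | pred k ihk =>
        have h7 : x j * a * (x j)⁻¹ = a * (rightComm a (x j))⁻¹ := by
          rw [eq_mul_inv_iff_mul_eq, mul_assoc, mul_assoc, ← h2.symm.inv_left.eq.symm,
            ← mul_assoc a, h6]
          group
        rw [zpow_sub_one, zpow_sub_one]
        calc _ = x j * ((x j ^ (-k : ℤ))⁻¹ * a * x j ^ (-k : ℤ)) * (x j)⁻¹ := by group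
          _ = (x j * a * (x j)⁻¹) * (x j * rightComm a (x j) ^ (-k : ℤ) * (x j)⁻¹) := by
            rw [ihk]; group
          _ = _ := by
            rw [h7, ← (h2.zpow_left (-k)).eq, mul_inv_cancel_right, mul_assoc,
              ← zpow_neg_one, ← zpow_add, ← zpow_add, add_comm]
    -- With c = [a, x_j], conjugation by x_j^k sends a to a c^k; as a and c commute, (a c^k)^M = a^M
    -- c^{kM}.
    calc rightComm (a ^ M) (x j ^ k) = (a ^ M)⁻¹ * ((x j ^ k)⁻¹ * a * x j ^ k) ^ M := by
          have h8 := conj_zpow (i := M) (a := (x j ^ k)⁻¹) (b := a)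
          rw [inv_inv] at h8
          rw [h8, rightComm]
          group
      _ = _ := by
          rw [h4, (h3.zpow_right k).mul_zpow, inv_mul_cancel_left, ← zpow_mul, mul_comm]

end CommutatorCalculus

/-! ### Products with the interval -/

section CompactlyGenerated

theorem compactlyGeneratedSpace_of_compact_t2 (K : Type u) [TopologicalSpace K] [CompactSpace K]
    [T2Space K] : CompactlyGeneratedSpace K :=
  uCompactlyGeneratedSpace_of_continuous_maps fun _ hf =>
    hf (CompHaus.of K) (ContinuousMap.id K)

-- Currying turns a test map on I × Z into a map from Z to C(I, W), and local compactness of I turns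
-- it back. This lets pointwise products be used on the domains of homotopies.
open unitInterval in
instance compactlyGeneratedSpace_unitInterval_prod {Z : Type u} [TopologicalSpace Z]
    [CompactlyGeneratedSpace Z] : CompactlyGeneratedSpace (I × Z) :=
  uCompactlyGeneratedSpace_of_continuous_maps fun {W} _ f hf => by
    have h1 : ∀ (S : CompHaus.{u}) (q : C(S, Z)), Continuous fun p : S × I => f (p.2, q p.1) :=
      fun S q => hf (CompHaus.of (S × I)) ⟨fun p => (p.2, q p.1), by fun_prop⟩
    have hs : ∀ z : Z, Continuous fun t : I => f (t, z) := fun z =>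
      (h1 (CompHaus.of PUnit) (ContinuousMap.const _ z)).comp (Continuous.prodMk_right PUnit.unit)
    let G : Z → C(I, W) := fun z => ⟨_, hs z⟩
    have hG : Continuous G := continuous_from_uCompactlyGeneratedSpace _ fun S q =>
      ContinuousMap.continuous_of_continuous_uncurry _ (h1 S q)
    exact (ContinuousMap.continuous_uncurry_of_continuous ⟨G, hG⟩).comp continuous_swap

end CompactlyGenerated

/-! ### Universal property and path connectedness of J(X) -/

namespace James

variable {X : Type u} {x₀ : X}

/-- The monoid homomorphism out of `J(X)` induced by a map killing the base point. -/
def lift {N : Type*} [Monoid N] (f : X → N) (hf : f x₀ = 1) : James x₀ →* N :=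
  (conGen fun a b : FreeMonoid X => a = FreeMonoid.of x₀ ∧ b = 1).lift (FreeMonoid.lift f)
    (Con.conGen_le.2 (by
      rintro a b ⟨rfl, rfl⟩
      simpa [Con.ker_rel] using hf))

@[simp]
theorem lift_of {N : Type*} [Monoid N] (f : X → N) (hf : f x₀ = 1) (x : X) :
    lift f hf (of x₀ x) = f x :=
  FreeMonoid.lift_eval_of f x

theorem lift_word {N : Type*} [Monoid N] (f : X → N) (hf : f x₀ = 1) (p : Σ k, CGPow X k) :
    lift f hf (word x₀ p) = (List.ofFn fun i => f (p.2 i)).prod := by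
  rw [word, map_list_prod, List.map_ofFn]
  congr 2

variable [TopologicalSpace X]

theorem continuous_mul {Z : Type u} [TopologicalSpace Z] [CompactlyGeneratedSpace Z]
    {f g : Z → James x₀} (hf : Continuous f) (hg : Continuous g) :
    Continuous fun z => f z * g z :=
  (mulMap ⟨f, hf⟩ ⟨g, hg⟩).continuous

theorem continuous_of_comp_word {Y : Type*} [TopologicalSpace Y] {f : James x₀ → Y}
    (h : ∀ k, Continuous fun x : CGPow X k => f (word x₀ ⟨k, x⟩)) : Continuous f :=
  continuous_coinduced_dom.2 (continuous_sigma h)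

theorem continuous_unop_list_prod {Z : Type u} [TopologicalSpace Z] [CompactlyGeneratedSpace Z]
    {k : ℕ} {f : Fin k → Z → James x₀} (hf : ∀ i, Continuous (f i)) :
    Continuous fun z => (List.ofFn fun i => MulOpposite.op (f i z)).prod.unop := by
  induction k with
  | zero => simpa using continuous_const
  | succ k ih =>
    simp only [List.ofFn_succ, List.prod_cons, MulOpposite.unop_mul, MulOpposite.unop_op]
    exact continuous_mul (ih fun i => hf i.succ) (hf 0)

/-- All letters of a word slide simultaneously to the base point. -/
instance [CompactlyGeneratedSpace X] [PathConnectedSpace X] : PathConnectedSpace (James x₀) := by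
  have h : ∀ w : James x₀, Joined 1 w := by
    intro w
    obtain ⟨⟨k, x⟩, rfl⟩ := word_surjective w
    have hp : ∀ i, Joined x₀ (x i) := fun i => PathConnectedSpace.joined _ _
    let q : unitInterval → CGPow X k := fun t i => (hp i).somePath t
    have hq : Continuous q := by
      have := CGPow.continuous_of_compHaus (CompHaus.of (ULift.{u} unitInterval))
        (fun t => q t.down) fun i => ((hp i).somePath.continuous.comp continuous_uliftDown)
      exact this.comp continuous_uliftUp
    refine ⟨⟨⟨fun t => word x₀ ⟨k, q t⟩, continuous_word.comp (continuous_sigmaMk.comp hq)⟩,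
      ?_, ?_⟩⟩
    · simp [q, word, of_base]
    · simp [q]
  exact ⟨⟨1⟩, fun a b => (h a).symm.trans (h b)⟩

end James

/-! ### Lifting properties of relative CW complexes -/

section

open CategoryTheory Limits HomotopicalAlgebra

/-- Relative CW complexes have the left lifting property against every map which has the right
lifting property against the inclusions of spheres into disks. -/
theorem TopCat.RelativeCWComplex.hasLiftingProperty {A Y : TopCat.{u}} {f : A ⟶ Y}
    (c : TopCat.RelativeCWComplex f) {T M : TopCat.{u}} (p : T ⟶ M)
    (hp : ∀ n, HasLiftingProperty (TopCat.diskBoundaryInclusion n) p) :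
    HasLiftingProperty f p := by
  let W : MorphismProperty TopCat.{u} :=
    MorphismProperty.ofHoms fun n : ℕ => TopCat.diskBoundaryInclusion.{u} n
  have h := c.transfiniteCompositionOfShape' (I := W) fun s =>
    MorphismProperty.ofHoms_iff _ _ |>.2 ⟨s.j, rfl⟩
  refine MorphismProperty.transfiniteCompositionsOfShape_pushouts_coproducts_le_llp_rlp W ℕ _ h.mem
    p ?_
  rintro _ _ _ ⟨n⟩
  exact hp n

end

/-! ### Left inverses of maps from CW complexes to J(X) -/

section

open CategoryTheory Limits HomotopicalAlgebra

section LeftInverses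

open unitInterval

variable {X : Type u} [TopologicalSpace X] (x₀ : X)

/-- Triples `(m, y, γ)` with `γ` a path in `J(X)` from `y * m` to `1`. -/
abbrev James.LeftInv : Type u :=
  {q : James x₀ × James x₀ × C(I, James x₀) // q.2.2 0 = q.2.1 * q.1 ∧ q.2.2 1 = 1}

variable {x₀}

theorem James.continuous_toLeftInv {Z : Type u} [TopologicalSpace Z] {m y : Z → James x₀}
    {P : Z × I → James x₀} (hm : Continuous m) (hy : Continuous y) (hP : Continuous P)
    (h0 : ∀ z, P (z, 0) = y z * m z) (h1 : ∀ z, P (z, 1) = 1) :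
    Continuous fun z => (⟨(m z, y z, ⟨fun s => P (z, s), by fun_prop⟩), h0 z, h1 z⟩ :
      James.LeftInv x₀) :=
  Continuous.subtype_mk (hm.prodMk (hy.prodMk
    (ContinuousMap.continuous_of_continuous_uncurry
      (fun z => (⟨fun s => P (z, s), by fun_prop⟩ : C(I, James x₀))) hP))) _

theorem James.LeftInv.ext {a b : James.LeftInv x₀} (h1 : a.1.1 = b.1.1) (h2 : a.1.2.1 = b.1.2.1)
    (h3 : ∀ s, a.1.2.2 s = b.1.2.2 s) : a = b :=
  Subtype.ext (Prod.ext h1 (Prod.ext h2 (ContinuousMap.ext h3)))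

/-- Extension of lifts to `James.LeftInv` over a cone. The base map is described by the path
`δ u` along the ray through `u`, followed by a path to the unit. -/
theorem James.LeftInv.exists_extension_cone {S : Type u} [TopologicalSpace S] [CompactSpace S]
    [T2Space S] (δ : S × ℝ → James x₀) (hδ : Continuous δ) (hδ2 : ∀ u s, 2 ≤ s → δ (u, s) = 1)
    (hδ1 : ∀ u u' s, 1 ≤ s → δ (u, s) = δ (u', s)) (ψ : S → James.LeftInv x₀) (hψ : Continuous ψ)
    (hψδ : ∀ u, (ψ u).1.1 = δ (u, 0)) :
    ∃ Ψ : S × I → James.LeftInv x₀, Continuous Ψ ∧ (∀ u, Ψ (u, 0) = ψ u) ∧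
      (∀ u e, (Ψ (u, e)).1.1 = δ (u, e)) ∧ ∀ u u', Ψ (u, 1) = Ψ (u', 1) := by
  let g : S → James x₀ := fun u => (ψ u).1.2.1
  have hg : Continuous g := by fun_prop
  let γ : S × ℝ → James x₀ := fun p => (ψ p.1).1.2.2 (Set.projIcc 0 1 zero_le_one p.2)
  have hγ : Continuous γ := by
    have : Continuous fun p : S × ℝ => (ψ p.1).1.2.2 := by fun_prop
    exact this.eval (by fun_prop)
  have hγ0 : ∀ u s, s ≤ 0 → γ (u, s) = g u * δ (u, 0) := fun u s hs => by
    simp only [γ, Set.projIcc_of_le_left _ hs]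
    rw [← hψδ]
    exact (ψ u).2.1
  have hγ1 : ∀ u s, 1 ≤ s → γ (u, s) = 1 := fun u s hs => by
    simp only [γ, Set.projIcc_of_right_le _ hs]
    exact (ψ u).2.2
  -- A path from g u to 1: run δ backwards from 1 to δ(u, 0) next to g u, during [0, 2], then follow
  -- the given path γ from g u · δ(u, 0) to 1, during [2, 3].
  let Λ : S × ℝ → James x₀ := fun p =>
    if p.2 ≤ 2 then g p.1 * δ (p.1, 2 - p.2) else γ (p.1, p.2 - 2)
  have hΛ : Continuous Λ := by
    refine Continuous.if_le (continuous_mul (by fun_prop) (by fun_prop)) (by fun_prop)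
      continuous_snd continuous_const fun p hp => ?_
    rw [hp, sub_self, hγ0 _ _ le_rfl]
  have hΛ0 : ∀ u, Λ (u, 0) = g u := fun u => by simp [Λ, hδ2]
  have hΛ3 : ∀ u s, 3 ≤ s → Λ (u, s) = 1 := fun u s hs => by
    simp only [Λ]
    rw [if_neg (by linarith), hγ1 _ _ (by linarith)]
  -- At cone height e the new left inverse is Λ(u, κ e). It stays g u for e ≤ 1/2 and reaches 1 at
  -- the apex, where dependence on u must disappear; θ e is how far δ is followed before Λ takes
  -- over.
  let θ : I → ℝ := fun e => min (4 * e) 2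
  let κ : I → ℝ := fun e => 3 * max (2 * (e : ℝ) - 1) 0
  have hθ : Continuous θ := by fun_prop
  have hκ : Continuous κ := by fun_prop
  -- First move δ from parameter e to θ e with Λ(u, κ e) fixed, then move along Λ. The legs meet
  -- because Λ(u, 2 - θ) = g u · δ(u, θ) when κ = 0, while δ = 1 once θ = 2. The speed 1 + 8e is 1
  -- at e = 0, so γ is recovered on the base, and θ ≤ 4e makes it fast enough to pass 3, the end of
  -- Λ.
  let P : (S × I) × I → James x₀ := fun p =>
    if p.2 * (1 + 8 * (p.1.2 : ℝ)) ≤ θ p.1.2 - p.1.2 then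
      Λ (p.1.1, κ p.1.2) * δ (p.1.1, p.1.2 + p.2 * (1 + 8 * (p.1.2 : ℝ)))
    else Λ (p.1.1, κ p.1.2 + 2 - θ p.1.2 + (p.2 * (1 + 8 * (p.1.2 : ℝ)) - (θ p.1.2 - p.1.2)))
  have hP : Continuous P := by
    refine Continuous.if_le (continuous_mul (by fun_prop) (by fun_prop)) (by fun_prop)
      (by fun_prop) (by fun_prop) ?_
    rintro ⟨⟨u, e⟩, s⟩ h
    simp only at h ⊢
    rw [h, sub_self, add_zero, add_sub_cancel]
    rcases le_total (e : ℝ) (1 / 2) with he | he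
    · have h1 : κ e = 0 := by simp only [κ]; rw [max_eq_right (by linarith), mul_zero]
      have h2 : θ e = 4 * e := min_eq_left (by linarith)
      have h3 := e.2.1
      simp only [Λ]
      rw [h1, if_pos (by norm_num), if_pos (by rw [h2]; linarith), sub_zero, hδ2 _ _ le_rfl,
        mul_one]
      congr 3
      ring
    · have h2 : θ e = 2 := min_eq_right (by linarith)
      rw [h2, hδ2 _ _ le_rfl, mul_one, add_sub_cancel_right]
  have hθ0 : ∀ e, θ e ≤ 4 * e := fun e => min_le_left _ _
  have hP0 : ∀ z : S × I, P (z, 0) = Λ (z.1, κ z.2) * δ (z.1, z.2) := by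
    rintro ⟨u, e⟩
    have h3 := e.2.1
    have h4 := e.2.2
    simp only [P]
    rw [if_pos]
    · simp
    · have : (e : ℝ) ≤ θ e := le_min (by linarith) (by linarith)
      simpa using this
  have hP1 : ∀ z : S × I, P (z, 1) = 1 := by
    rintro ⟨u, e⟩
    have h3 := e.2.1
    have h5 := hθ0 e
    have h6 : 0 ≤ κ e := by simp only [κ]; positivity
    simp only [P, Set.Icc.coe_one, one_mul]
    rw [if_neg (by linarith), hΛ3 _ _ (by linarith)]
  refine ⟨fun z => ⟨(δ (z.1, z.2), Λ (z.1, κ z.2), ⟨fun s => P (z, s), by fun_prop⟩), hP0 z, hP1 z⟩,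
    continuous_toLeftInv (by fun_prop) (by fun_prop) hP hP0 hP1, fun u => ?_, fun u e => rfl,
    fun u u' => ?_⟩
  · have hκ0 : κ 0 = 0 := by simp only [κ]; norm_num
    have hθ0 : θ 0 = 0 := by simp only [θ]; norm_num
    refine James.LeftInv.ext (hψδ u).symm ?_ fun s => ?_
    · simp only [hκ0]
      exact hΛ0 u
    · have h3 := s.2.1
      simp only [ContinuousMap.coe_mk, P, hκ0, hθ0, Set.Icc.coe_zero, mul_zero, add_zero, sub_zero,
        mul_one, zero_add]
      split_ifs with h
      · have h0 : s = 0 := le_antisymm h h3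
        have h6 := (ψ u).2.1
        rw [hψδ] at h6
        rw [h0, hΛ0, h6]
        rfl
      · have h4 : (0 : ℝ) < s := not_le.1 h
        simp only [Λ]
        rw [if_neg (by linarith)]
        simp [γ]
  · have hκ1 : κ 1 = 3 := by
      simp only [κ, Set.Icc.coe_one]
      rw [max_eq_left] <;> norm_num

    have hθ1 : θ 1 = 2 := by simp only [θ]; norm_num
    refine James.LeftInv.ext (hδ1 _ _ _ (by simp)) ?_ fun s => ?_
    · simp only [hκ1]
      rw [hΛ3 _ _ le_rfl, hΛ3 _ _ le_rfl]
    · have h3 := s.2.1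
      simp only [ContinuousMap.coe_mk, P, hκ1, hθ1, Set.Icc.coe_one]
      split_ifs with h
      · rw [hΛ3 _ _ le_rfl, hΛ3 _ _ le_rfl, hδ1 u u' _ (by linarith)]
      · rw [hΛ3 _ _ (by linarith), hΛ3 _ _ (by linarith)]

/-- The point at distance `1 - e` from the center on the ray through a point of the sphere. -/
def diskRay (n : ℕ) (p : ULift.{u} (Metric.sphere (0 : EuclideanSpace ℝ (Fin n)) 1) × I) :
    ULift.{u} (Metric.closedBall (0 : EuclideanSpace ℝ (Fin n)) 1) :=
  ⟨⟨(1 - (p.2 : ℝ)) • p.1.down.1, by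
    have h1 : ‖p.1.down.1‖ = 1 := by simp
    rw [mem_closedBall_zero_iff, norm_smul, h1, mul_one, Real.norm_eq_abs, abs_of_nonneg]
    · linarith [p.2.2.1]
    · linarith [p.2.2.2]⟩⟩

theorem continuous_diskRay (n : ℕ) : Continuous (diskRay.{u} n) := by
  unfold diskRay
  fun_prop

/-- A continuous surjection from a compact space to a Hausdorff one. For n = 0 the sphere is empty
and the centre is missed. -/
theorem isQuotientMap_diskRay {n : ℕ} (hn : n ≠ 0) : IsQuotientMap (diskRay.{u} n) := by
  refine IsQuotientMap.of_surjective_continuous ?_ (continuous_diskRay n)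
  rintro ⟨⟨z, hz⟩⟩
  have hz1 : ‖z‖ ≤ 1 := by simpa using hz
  by_cases h0 : z = 0
  · have : Nonempty (Fin n) := ⟨⟨0, Nat.pos_of_ne_zero hn⟩⟩
    obtain ⟨w, hw⟩ := (NormedSpace.sphere_nonempty (E := EuclideanSpace ℝ (Fin n)) (x := 0)
      (r := 1)).2 zero_le_one
    refine ⟨⟨⟨⟨w, hw⟩⟩, 1⟩, ?_⟩
    simp [diskRay, h0]
  · have h1 : ‖z‖ ≠ 0 := norm_ne_zero_iff.2 h0
    refine ⟨⟨⟨⟨‖z‖⁻¹ • z, ?_⟩⟩, ⟨1 - ‖z‖, by linarith, by linarith [norm_nonneg z]⟩⟩, ?_⟩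
    · simp [norm_smul, h1]
    · simp [diskRay, smul_smul, h1]

theorem diskRay_eq {n : ℕ} {p q : ULift.{u} (Metric.sphere (0 : EuclideanSpace ℝ (Fin n)) 1) × I}
    (h : diskRay n p = diskRay n q) : p.2 = q.2 ∧ (p.2 = 1 ∨ p.1 = q.1) := by
  obtain ⟨⟨⟨u, hu⟩⟩, e⟩ := p
  obtain ⟨⟨⟨w, hw⟩⟩, e'⟩ := q
  have h1 : (1 - (e : ℝ)) • u = (1 - (e' : ℝ)) • w := congrArg (fun z => z.down.1) h
  have hu1 : ‖u‖ = 1 := by simpa using hu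
  have hw1 : ‖w‖ = 1 := by simpa using hw
  have h2 : (e : ℝ) = e' := by
    have h3 := congrArg norm h1
    rw [norm_smul, norm_smul, hu1, hw1, mul_one, mul_one, Real.norm_eq_abs, Real.norm_eq_abs,
      abs_of_nonneg (by linarith [e.2.2]), abs_of_nonneg (by linarith [e'.2.2])] at h3
    linarith
  have h3 : e = e' := Subtype.ext h2
  subst h3
  refine ⟨rfl, ?_⟩
  by_cases he : (1 - (e : ℝ)) = 0
  · exact Or.inl (Subtype.ext (sub_eq_zero.1 he).symm)
  · have := smul_right_injective _ he h1
    subst this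
    exact Or.inr rfl

/-- The disk is the cone on its sphere. Following f along a ray to the centre and then a path `c`
from its central value to 1 gives the path data required for the cone; when n = 0, `c` alone
supplies the left inverse 1. -/
theorem James.LeftInv.exists_extension_disk [CompactlyGeneratedSpace X] [PathConnectedSpace X]
    (n : ℕ)
    (ψ : C(ULift.{u} (Metric.sphere (0 : EuclideanSpace ℝ (Fin n)) 1), James.LeftInv x₀))
    (f : C(ULift.{u} (Metric.closedBall (0 : EuclideanSpace ℝ (Fin n)) 1), James x₀))
    (h : ∀ u, (ψ u).1.1 = f (diskRay n (u, 0))) :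
    ∃ Ψ : C(ULift.{u} (Metric.closedBall (0 : EuclideanSpace ℝ (Fin n)) 1), James.LeftInv x₀),
      (∀ u, Ψ (diskRay n (u, 0)) = ψ u) ∧ ∀ z, (Ψ z).1.1 = f z := by
  let z₀ : ULift.{u} (Metric.closedBall (0 : EuclideanSpace ℝ (Fin n)) 1) := ⟨⟨0, by simp⟩⟩
  have c : Path (f z₀) 1 := (PathConnectedSpace.joined _ _).somePath
  by_cases hn : n = 0
  · subst hn
    have h0 : ∀ z, f z = f z₀ := fun z => congrArg f (ULift.ext _ _ (Subsingleton.elim _ _))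
    refine ⟨ContinuousMap.const _ ⟨(f z₀, 1, c.toContinuousMap), by simp, by simp⟩, ?_, ?_⟩
    · rintro ⟨⟨u, hu⟩⟩
      have hu1 : ‖u‖ = 1 := by simpa using hu
      simp [Subsingleton.elim u 0] at hu1
    · exact fun z => (h0 z).symm
  · let δ : ULift.{u} (Metric.sphere (0 : EuclideanSpace ℝ (Fin n)) 1) × ℝ → James x₀ := fun p =>
      if p.2 ≤ 1 then f (diskRay n (p.1, Set.projIcc 0 1 zero_le_one p.2)) else c.extend (p.2 - 1)
    have hδ1 : ∀ u s, 1 ≤ s → δ (u, s) = c.extend (s - 1) := by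
      intro u s hs
      simp only [δ]
      split_ifs with h1
      · obtain rfl := le_antisymm h1 hs
        simp [diskRay, z₀]
      · rfl
    have hδe : ∀ u (e : I), δ (u, e) = f (diskRay n (u, e)) := by
      intro u e
      simp only [δ]
      rw [if_pos e.2.2, Set.projIcc_val]
    have hδ : Continuous δ := by
      refine Continuous.if_le ?_ ?_ continuous_snd continuous_const fun p hp => ?_
      · exact f.continuous.comp ((continuous_diskRay n).comp (by fun_prop))
      · exact c.continuous_extend.comp (by fun_prop)
      · rw [hp]
        simp [diskRay, z₀]
    obtain ⟨Ψ, hΨ, hΨ0, hΨδ, hΨ1⟩ := James.LeftInv.exists_extension_cone δ hδ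
      (fun u s hs => by rw [hδ1 u s (by linarith), c.extend_of_one_le (by linarith)])
      (fun u u' s hs => by rw [hδ1 u s hs, hδ1 u' s hs]) ψ ψ.continuous
      (fun u => by rw [h u, ← hδe u 0]; rfl)
    let r : C(ULift.{u} (Metric.sphere (0 : EuclideanSpace ℝ (Fin n)) 1) × I,
        ULift.{u} (Metric.closedBall (0 : EuclideanSpace ℝ (Fin n)) 1)) :=
      ⟨diskRay n, continuous_diskRay n⟩
    have hq : IsQuotientMap r := isQuotientMap_diskRay.{u} hn
    have hΨq : Function.FactorsThrough (⟨Ψ, hΨ⟩ : C(_, James.LeftInv x₀)) r := by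
      rintro ⟨u, e⟩ ⟨w, e'⟩ hpq
      obtain ⟨h1, h2⟩ := diskRay_eq hpq
      simp only at h1 h2
      subst h1
      rcases h2 with rfl | rfl
      · exact hΨ1 _ _
      · rfl
    refine ⟨hq.lift ⟨Ψ, hΨ⟩ hΨq, fun u => ?_, fun z => ?_⟩
    · rw [← hΨ0]
      exact DFunLike.congr_fun (hq.lift_comp ⟨Ψ, hΨ⟩ hΨq) (u, 0)
    · obtain ⟨⟨u, e⟩, rfl⟩ := hq.surjective z
      refine Eq.trans ?_ ((hΨδ u e).trans (hδe u e))
      exact congrArg (fun k : James.LeftInv x₀ => k.1.1)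
        (DFunLike.congr_fun (hq.lift_comp ⟨Ψ, hΨ⟩ hΨq) (u, e))

/-- Every map from a CW complex to the James construction of a path connected space has a left
inverse up to homotopy. -/
theorem James.exists_mulMap_homotopic_one_of_CWComplex [CompactlyGeneratedSpace X]
    [PathConnectedSpace X] {Y : TopCat.{u}} (hY : TopCat.CWComplex Y) (f : C(Y, James x₀)) :
    ∃ (g : C(Y, James x₀)) (P : C(Y × I, James x₀)),
      (∀ y, P (y, 0) = g y * f y) ∧ ∀ y, P (y, 1) = 1 := by
  let p : TopCat.of (James.LeftInv x₀) ⟶ TopCat.of (James x₀) :=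
    TopCat.ofHom ⟨fun q => q.1.1, by fun_prop⟩
  have hp : ∀ n, HasLiftingProperty (TopCat.diskBoundaryInclusion.{u} n) p := by
    refine fun n => ⟨fun {a b} sq => ?_⟩
    obtain ⟨Ψ, h1, h2⟩ := James.LeftInv.exists_extension_disk n a.hom b.hom fun u => by
      have := congrArg (fun k => k.hom u) sq.w
      refine this.trans ?_
      change b.hom _ = b.hom _
      congr 1
      refine ULift.ext _ _ (Subtype.ext ?_)
      simp [diskRay]
      rfl
    refine ⟨⟨⟨TopCat.ofHom Ψ, ?_, ?_⟩⟩⟩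
    · ext u : 1
      refine Eq.trans ?_ (h1 u)
      change Ψ _ = Ψ _

      congr 1
      refine ULift.ext _ _ (Subtype.ext ?_)
      simp [diskRay]
      rfl
    · ext z : 1
      exact h2 z
  -- A lift of f through p chooses left inverses together with their contracting paths, continuously
  -- over Y.
  have := hY.hasLiftingProperty p hp
  have sq : CommSq (initial.to (TopCat.of (James.LeftInv x₀))) (initial.to Y) p (TopCat.ofHom f) :=
    ⟨initial.hom_ext _ _⟩
  have hl : ∀ y, (sq.lift.hom y).1.1 = f y := fun y =>
    congrArg (fun k => k.hom y) sq.fac_right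
  have hl2 : Continuous fun y => (sq.lift.hom y).1.2.2 := by
    have := sq.lift.hom.continuous
    fun_prop
  refine ⟨⟨fun y => (sq.lift.hom y).1.2.1, by
    have := sq.lift.hom.continuous
    fun_prop⟩, ⟨fun q => (sq.lift.hom q.1).1.2.2 q.2, ?_⟩, fun y => ?_, fun y => ?_⟩
  · exact (hl2.comp continuous_fst).eval continuous_snd
  · rw [← hl y]
    exact (sq.lift.hom y).2.1
  · exact (sq.lift.hom y).2.2

end LeftInverses

end

/-! ### Relative homotopies -/

section Homotopies

open unitInterval

variable {Z Y : Type u} [TopologicalSpace Z] [TopologicalSpace Y]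

theorem ContinuousMap.HomotopicRel.of_map {f g : C(Z, Y)} {S : Set Z} (F : I × Z → Y)
    (hF : Continuous F) (h0 : ∀ z, F (0, z) = f z) (h1 : ∀ z, F (1, z) = g z)
    (hS : ∀ t, ∀ z ∈ S, F (t, z) = f z) : f.HomotopicRel g S :=
  ⟨{ toFun := F
     continuous_toFun := hF
     map_zero_left := h0
     map_one_left := h1
     prop' := hS }⟩

theorem ContinuousMap.HomotopicRel.mono {f g : C(Z, Y)} {S T : Set Z} (h : f.HomotopicRel g S)
    (hT : T ⊆ S) : f.HomotopicRel g T := by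
  obtain ⟨F⟩ := h
  exact .of_map F F.continuous (fun z => by simp) (fun z => by simp)
    fun t z hz => F.eq_fst t (hT hz)

theorem ContinuousMap.HomotopicRel.comp_right {W : Type u} [TopologicalSpace W] {f g : C(Z, Y)}
    {S : Set Z} (h : f.HomotopicRel g S) (k : C(W, Z)) {T : Set W} (hk : Set.MapsTo k T S) :
    (f.comp k).HomotopicRel (g.comp k) T := by
  obtain ⟨F⟩ := h
  exact .of_map (fun p => F (p.1, k p.2)) (by fun_prop) (fun z => by simp) (fun z => by simp)
    fun t z hz => F.eq_fst t (hk hz)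

end Homotopies

/-! ### A pointed left inverse of E -/

section LeftInverseOfE

open unitInterval

variable {X : Type u} [TopologicalSpace X] [CompactlyGeneratedSpace X] {x₀ : X}

/-- The CW result is transported along a homotopy equivalence. That equivalence is unpointed, so
only a free homotopy is obtained here. -/
theorem James.exists_homotopic_mulMap_E [PathConnectedSpace X] (hCW : HasCWHomotopyType X) :
    ∃ g : C(X, James x₀), (James.mulMap g (James.E x₀)).HomotopicRel (ContinuousMap.const X 1) ∅ := by
  obtain ⟨Y, ⟨hY⟩, ⟨e⟩⟩ := hCW
  obtain ⟨g, P, hP0, hP1⟩ := James.exists_mulMap_homotopic_one_of_CWComplex hY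
    ((James.E x₀).comp e.invFun)
  refine ⟨g.comp e.toFun, ?_⟩
  have h1 : (James.mulMap (g.comp e.toFun) ((James.E x₀).comp (e.invFun.comp e.toFun))).HomotopicRel
      (ContinuousMap.const X 1) ∅ :=
    .of_map (fun p => P (e.toFun p.2, p.1)) (by fun_prop) (fun x => hP0 _) (fun x => hP1 _)
      fun _ _ h => h.elim
  refine ContinuousMap.HomotopicRel.trans ?_ h1
  refine James.mulMap_homotopicRel (.refl _) ?_
  have h2 := (ContinuousMap.homotopicRel_empty.2 e.left_inv).symm.comp_continuousMap (James.E x₀)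
  exact h2

/-- Over a well-pointed path connected space of the homotopy type of a CW complex, the canonical
map to the James construction has a pointed left inverse up to pointed homotopy. -/
theorem James.exists_leftInverse_E [PathConnectedSpace X] (hx₀ : NondegenerateBasepoint x₀)
    (hCW : HasCWHomotopyType X) :
    ∃ g : C(X, James x₀), g x₀ = 1 ∧
      (James.mulMap g (James.E x₀)).HomotopicRel (ContinuousMap.const X 1) {x₀} := by
  obtain ⟨v, h, hv, h0, hb, h1⟩ := hx₀
  obtain ⟨g, ⟨K⟩⟩ := James.exists_homotopic_mulMap_E (x₀ := x₀) hCW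
  have hE : James.E x₀ x₀ = 1 := James.of_base
  have hK0 : ∀ x, K (0, x) = g x * James.E x₀ x := fun x => K.apply_zero x
  have hK1 : ∀ x, K (1, x) = 1 := fun x => K.apply_one x
  -- A collar coordinate: 1 at the base point, 0 at height 1/2.
  let κ : X → I := fun x => Set.projIcc 0 1 zero_le_one (1 - 2 * (v x : ℝ))
  have hκ : Continuous κ := by fun_prop
  have hκ0 : ∀ x, (v x : ℝ) = 1 / 2 → κ x = 0 := fun x hx =>
    Set.projIcc_of_le_left _ (by rw [hx]; norm_num)
  have hκ1 : κ x₀ = 1 := Set.projIcc_of_right_le _ (by simp [(hv x₀).2 rfl])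
  have hh : ∀ x, (v x : ℝ) ≤ 1 / 2 → h (1, x) = x₀ := fun x hx =>
    h1 x (Subtype.coe_lt_coe.1 (by simp only [Set.Icc.coe_one]; linarith))
  -- The collar is collapsed by h and filled with the track of the base point under K, which runs
  -- from g x₀ to 1.
  let g' : C(X, James x₀) := ⟨fun x => if (v x : ℝ) ≤ 1 / 2 then K (κ x, x₀) else g (h (1, x)), by
    refine Continuous.if_le (by fun_prop) (by fun_prop) (by fun_prop) continuous_const
      fun x hx => ?_
    rw [hκ0 x hx, hK0, hE, mul_one, hh x hx.le]⟩
  have hg' : g' x₀ = 1 := by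
    have : (v x₀ : ℝ) ≤ 1 / 2 := by simp [(hv x₀).2 rfl]
    simp only [g', ContinuousMap.coe_mk, if_pos this, hκ1, hK1]
  let hh1 : C(X, X) := ⟨fun x => h (1, x), by fun_prop⟩
  have h2 : (James.mulMap g' ((James.E x₀).comp hh1)).HomotopicRel (ContinuousMap.const X 1)
      {x₀} := by
    -- Taking `max` with κ leaves the base point at time 1 throughout, which makes the homotopy
    -- pointed.
    refine .of_map (fun p => if (v p.2 : ℝ) ≤ 1 / 2 then K (max p.1 (κ p.2), x₀) else
      K (p.1, h (1, p.2))) ?_ (fun x => ?_) (fun x => ?_) ?_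
    · refine Continuous.if_le (by fun_prop) (by fun_prop) (by fun_prop) continuous_const
        fun x hx => ?_
      rw [hκ0 _ hx, hh _ hx.le]
      congr 2
      exact max_eq_left x.1.2.1
    · by_cases hx : (v x : ℝ) ≤ 1 / 2
      · have : max 0 (κ x) = κ x := max_eq_right (κ x).2.1
        simp only [James.mulMap, ContinuousMap.coe_mk, g', hx, if_true, this, ContinuousMap.comp_apply,
          hh1, hh x hx, hE, mul_one]
      · simp only [James.mulMap, ContinuousMap.coe_mk, g', hx, if_false, ContinuousMap.comp_apply,
          hh1]
        exact hK0 _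
    · have : max 1 (κ x) = 1 := max_eq_left (κ x).2.2
      simp [this]
    · rintro t x rfl
      have h3 : (v x : ℝ) ≤ 1 / 2 := by simp [(hv x).2 rfl]
      have : max t (κ x) = 1 := by rw [hκ1]; exact max_eq_right t.2.2
      simp only [h3, if_true, this, hK1]
      simp [James.mulMap, hg', hh1, hb, hE]
  refine ⟨g', hg', ContinuousMap.HomotopicRel.trans ?_ h2⟩
  refine James.mulMap_homotopicRel (.refl _) (.of_map (fun p => James.E x₀ (h p)) (by fun_prop)
    (fun x => by simp [h0]) (fun x => rfl) ?_)
  rintro t x rfl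
  simp [hb]

end LeftInverseOfE

/-! ### A left inverse of the identity of J(X), by timed cancellation of letters -/

section InverseMap

open unitInterval MulOpposite

namespace James

variable {X : Type u} {x₀ : X}

theorem induction_on {p : James x₀ → Prop} (w : James x₀) (h1 : p 1)
    (h : ∀ x w, p w → p (of x₀ x * w)) : p w := by
  obtain ⟨l, rfl⟩ := Con.mk'_surjective w
  induction l using FreeMonoid.inductionOn' with
  | one => exact h1
  | of_mul x l ih =>
    rw [map_mul]
    exact h x _ ih

/-- The transformation of `J(X) × ℝ` by a letter `x`: at non-positive times multiply on the left by
`g x` and on the right by `x`, at positive times multiply by `k`; then subtract `v x` from the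
time. -/
noncomputable def letterAct (v : X → ℝ) (g : X → James x₀) (k : ℝ → X → James x₀) (x : X) :
    Function.End (James x₀ × ℝ) :=
  fun ρ => (if ρ.2 ≤ 0 then g x * ρ.1 * of x₀ x else ρ.1 * k ρ.2 x, ρ.2 - v x)

variable {v : X → ℝ} {g : X → James x₀} {k : ℝ → X → James x₀}
  (hv : v x₀ = 0) (hg : g x₀ = 1) (hk : ∀ s, k s x₀ = 1)

/-- The action of words on `J(X) × ℝ`, the first letter acting first. -/
noncomputable def wordAct : James x₀ →* (Function.End (James x₀ × ℝ))ᵐᵒᵖ :=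
  lift (fun x => op (letterAct v g k x)) (by
    refine MulOpposite.unop_injective (funext fun ρ => ?_)
    simp [letterAct, hv, hg, hk, of_base, Function.End.one_def])

/-- The total length of a word. -/
noncomputable def wordLength : James x₀ →* Multiplicative ℝ :=
  lift (fun x => Multiplicative.ofAdd (v x)) (by simp [hv])

/-- The antihomomorphism `J(X) → J(X)` extending `g`. -/
noncomputable def antiLift : James x₀ →* (James x₀)ᵐᵒᵖ :=
  lift (fun x => op (g x)) (by simp [hg])

theorem wordAct_of_mul (x : X) (w : James x₀) (ρ : James x₀ × ℝ) :
    (wordAct hv hg hk (of x₀ x * w)).unop ρ =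
      (wordAct hv hg hk w).unop (letterAct v g k x ρ) := by
  rw [map_mul, unop_mul, wordAct, lift_of]
  rfl

theorem wordAct_snd (w : James x₀) (ρ : James x₀ × ℝ) :
    ((wordAct hv hg hk w).unop ρ).2 = ρ.2 - (wordLength hv w).toAdd := by
  induction w using induction_on generalizing ρ with
  | h1 => simp [Function.End.one_def]
  | h x w ih =>
    rw [wordAct_of_mul, ih, map_mul, toAdd_mul, wordLength, lift_of]
    simp only [letterAct, toAdd_ofAdd]
    ring

theorem wordLength_nonneg (hv0 : ∀ x, 0 ≤ v x) (w : James x₀) : 0 ≤ (wordLength hv w).toAdd := by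
  induction w using induction_on with
  | h1 => simp
  | h x w ih =>
    rw [map_mul, toAdd_mul, wordLength, lift_of]
    exact add_nonneg (hv0 x) ih

/-- With no time left, nothing cancels and the letters accumulate on both sides. This is the start
of the contraction. -/
theorem wordAct_of_nonpos (hv0 : ∀ x, 0 ≤ v x) (w : James x₀) (ρ : James x₀ × ℝ) (hr : ρ.2 ≤ 0) :
    ((wordAct hv hg hk w).unop ρ).1 = (antiLift hg w).unop * ρ.1 * w := by
  induction w using induction_on generalizing ρ with
  | h1 => simp [Function.End.one_def]
  | h x w ih =>
    rw [wordAct_of_mul, ih, map_mul, unop_mul, antiLift, lift_of]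
    · simp [letterAct, hr, mul_assoc]
    · simp only [letterAct]
      linarith [hv0 x]

/-- The invariant of the contraction: while time remains nonnegative, every letter read so far has
cancelled completely. A letter of positive height needs at least time v x, and a letter of height 0
is the base point. -/
theorem letterAct_fst_eq_one (hv0 : ∀ x, v x = 0 → x = x₀) (hv1 : ∀ x, 0 ≤ v x)
    (hg : g x₀ = 1) (hk1 : ∀ x s, 0 < s → v x ≤ s → k s x = 1) (x : X) (ρ : James x₀ × ℝ)
    (hr : 0 ≤ ρ.2 → ρ.1 = 1) (h : 0 ≤ (letterAct v g k x ρ).2) : (letterAct v g k x ρ).1 = 1 := by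
  simp only [letterAct] at h ⊢
  have h1 := hv1 x
  rw [hr (by linarith)]
  split_ifs with h2
  · have h3 : x = x₀ := hv0 x (by linarith)
    simp [h3, hg, of_base]
  · rw [one_mul, hk1 x _ (by linarith) (by linarith)]

theorem wordAct_fst_eq_one (hv0 : ∀ x, v x = 0 → x = x₀) (hv1 : ∀ x, 0 ≤ v x)
    (hk1 : ∀ x s, 0 < s → v x ≤ s → k s x = 1) (w : James x₀) (ρ : James x₀ × ℝ)
    (hr : 0 ≤ ρ.2 → ρ.1 = 1) (h : 0 ≤ ((wordAct hv hg hk w).unop ρ).2) :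
    ((wordAct hv hg hk w).unop ρ).1 = 1 := by
  induction w using induction_on generalizing ρ with
  | h1 => exact hr h
  | h x w ih =>
    rw [wordAct_of_mul] at h ⊢
    exact ih _ (letterAct_fst_eq_one hv0 hv1 hg hk1 x ρ hr) h

variable [TopologicalSpace X]

/-- The two branches of a letter's action agree at time 0 only because the accumulated element is
then 1: both give g x · x. Hence the induction carries the invariant `hr1`. -/
theorem continuous_wordAct_word [CompactlyGeneratedSpace X] (hv0 : ∀ x, v x = 0 → x = x₀) (hv1 : ∀ x, 0 ≤ v x)
    (hk1 : ∀ x s, 0 < s → v x ≤ s → k s x = 1) (hk0 : ∀ x s, s ≤ 0 → k s x = g x * of x₀ x)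
    (hvc : Continuous v) (hgc : Continuous g) (hkc : Continuous fun p : ℝ × X => k p.1 p.2)
    {Z : Type u} [TopologicalSpace Z] [CompactlyGeneratedSpace Z] (l : ℕ) (b : Z → CGPow X l)
    (hb : ∀ i, Continuous fun z => b z i)
    (ρ : Z → James x₀ × ℝ) (hr : Continuous ρ) (hr1 : ∀ z, 0 ≤ (ρ z).2 → (ρ z).1 = 1) :
    Continuous fun z => (wordAct hv hg hk (word x₀ ⟨l, b z⟩)).unop (ρ z) := by
  induction l generalizing ρ with
  | zero =>
    have h1 : ∀ z, word x₀ ⟨0, b z⟩ = 1 := fun z => by simp [word]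
    simp only [h1, map_one]
    exact hr
  | succ l ih =>
    have h1 : ∀ z, word x₀ ⟨l + 1, b z⟩ =
        of x₀ (b z 0) * word x₀ ⟨l, (fun i : Fin l => b z i.succ : CGPow X l)⟩ := fun z => by
      simp [word, List.ofFn_succ]
    simp only [h1, wordAct_of_mul]
    refine ih (fun z => fun i : Fin l => b z i.succ) (fun i => hb _)
      (fun z => letterAct v g k (b z 0) (ρ z)) ?_
      fun z => letterAct_fst_eq_one hv0 hv1 hg hk1 _ _ (hr1 z)
    have h2 := hb 0
    have h3 : Continuous fun z => (ρ z).1 := by fun_prop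
    have h4 : Continuous fun z => (ρ z).2 := by fun_prop
    refine Continuous.prodMk ?_ (by fun_prop)
    refine Continuous.if_le ?_ ?_ h4 continuous_const fun z hz => ?_
    · exact continuous_mul (continuous_mul (hgc.comp h2) h3) ((E x₀).continuous.comp h2)
    · exact continuous_mul h3 (hkc.comp (h4.prodMk h2))
    · rw [hr1 z hz.ge, one_mul, mul_one, hz, hk0 _ _ le_rfl]

theorem continuous_wordLength (hvc : Continuous v) :
    Continuous fun w : James x₀ => (wordLength hv w).toAdd := by
  refine continuous_of_comp_word fun l => ?_
  simp only [wordLength, lift_word, List.prod_ofFn, toAdd_prod, toAdd_ofAdd]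
  exact continuous_finsetSum _ fun i _ => hvc.comp (CGPow.continuous_apply i)

theorem continuous_antiLift (hgc : Continuous g) :
    Continuous fun w : James x₀ => (antiLift hg w).unop := by
  refine continuous_of_comp_word fun l => ?_
  simp only [antiLift, lift_word]
  exact continuous_unop_list_prod fun i => hgc.comp (CGPow.continuous_apply i)

/-- A homotopy from `χ₁ · E` to the constant map can be reparametrised so that it reaches the unit
at time `v x`. -/
theorem continuous_homotopy_div {u : C(X, I)} (hu : ∀ x, u x = 0 ↔ x = x₀)
    {H : I × X → James x₀} (hH : Continuous H) (hH1 : ∀ t, H (t, x₀) = 1) :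
    Continuous fun p : ℝ × X => H (Set.projIcc 0 1 zero_le_one (p.1 / u p.2), p.2) := by
  refine continuous_iff_continuousAt.2 ?_
  rintro ⟨s, x⟩
  by_cases hx : x = x₀
  -- The quotient s / u is uncontrolled near the base point, but H is 1 on all of I × {x₀};
  -- compactness of I sends I × (a neighbourhood) into U.
  · subst hx
    have h1 : H (Set.projIcc 0 1 zero_le_one (s / u x), x) = 1 := hH1 _
    rw [ContinuousAt, h1]
    intro U hU
    have h2 : ∀ᶠ y in 𝓝 x, ∀ t ∈ (Set.univ : Set I), H (t, y) ∈ U := by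
      refine isCompact_univ.eventually_forall_of_forall_eventually fun t _ => ?_
      have h3 : Filter.Tendsto (fun z : X × I => H (z.2, z.1)) (𝓝 (x, t)) (𝓝 1) := by
        have : Continuous fun z : X × I => H (z.2, z.1) := by fun_prop
        have := this.tendsto (x, t)
        rwa [hH1] at this
      exact h3 hU
    rw [nhds_prod_eq]
    exact (h2.prod_inr (𝓝 s)).mono fun p hp => hp _ trivial
  · have h1 : (u x : ℝ) ≠ 0 := fun h => hx ((hu x).1 (Subtype.ext h))
    have h2 : ContinuousAt (fun p : ℝ × X => p.1 / (u p.2 : ℝ)) (s, x) :=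
      continuousAt_fst.div (by fun_prop) h1
    exact hH.continuousAt.comp
      ((continuous_projIcc.continuousAt.comp h2).prodMk continuousAt_snd)

/-- Over a well-pointed path connected space of the homotopy type of a CW complex, the identity of
the James construction has a left inverse up to a pointed homotopy. -/
theorem exists_leftInverse [CompactlyGeneratedSpace X] [PathConnectedSpace X]
    (hx₀ : NondegenerateBasepoint x₀) (hCW : HasCWHomotopyType X) :
    ∃ (χ : C(James x₀, James x₀)) (G : C(I × James x₀, James x₀)), χ 1 = 1 ∧
      (∀ w, G (0, w) = χ w * w) ∧ (∀ w, G (1, w) = 1) ∧ ∀ t, G (t, 1) = 1 := by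
  obtain ⟨g, hg, ⟨H⟩⟩ := exists_leftInverse_E hx₀ hCW
  obtain ⟨u, -, hu, -⟩ := hx₀
  have hH0 : ∀ x, H (0, x) = g x * of x₀ x := fun x => H.apply_zero x
  have hH1 : ∀ x, H (1, x) = 1 := fun x => H.apply_one x
  have hHx : ∀ t, H (t, x₀) = 1 := fun t => (H.eq_fst t rfl).trans (by
    have : E x₀ x₀ = 1 := of_base
    simp [mulMap, hg, this])
  let v : X → ℝ := fun x => u x
  let k : ℝ → X → James x₀ := fun s x => H (Set.projIcc 0 1 zero_le_one (s / u x), x)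
  have hv : v x₀ = 0 := by simp [v, (hu x₀).2 rfl]
  have hv0 : ∀ x, v x = 0 → x = x₀ := fun x hx => (hu x).1 (Subtype.ext hx)
  have hv1 : ∀ x, 0 ≤ v x := fun x => (u x).2.1
  have hk : ∀ s, k s x₀ = 1 := fun s => hHx _
  have hk1 : ∀ x s, 0 < s → v x ≤ s → k s x = 1 := by
    intro x s hs hxs
    by_cases hx : v x = 0
    · rw [hv0 x hx, hk]
    · have h1 : 0 < v x := lt_of_le_of_ne (hv1 x) (Ne.symm hx)
      simp only [k]
      rw [Set.projIcc_of_right_le _ ((one_le_div h1).2 hxs)]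
      exact hH1 x
  have hk0 : ∀ x s, s ≤ 0 → k s x = g x * of x₀ x := by
    intro x s hs
    simp only [k]
    rw [Set.projIcc_of_le_left _ (div_nonpos_of_nonpos_of_nonneg hs (hv1 x))]
    exact hH0 x
  have hvc : Continuous v := by fun_prop
  have hkc := continuous_homotopy_div hu H.continuous hHx
  let L : James x₀ → ℝ := fun w => (wordLength hv w).toAdd
  have hL : Continuous L := continuous_wordLength hv hvc
  have hL0 : ∀ w, 0 ≤ L w := wordLength_nonneg hv hv1
  -- The time budget is t times the total height of the word: at t = 0 no letter cancels, at t = 1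
  -- the budget lasts exactly to the end. Letters cancel from the middle of χ(w) w outwards.
  let F : I → James x₀ → James x₀ := fun t w => ((wordAct hv hg hk w).unop (1, t * L w)).1
  have hF : Continuous fun p : I × James x₀ => F p.1 p.2 := by
    have h0 : ∀ (Z : Type u) [TopologicalSpace Z], CompactlyGeneratedSpace Z →
        ∀ (l : ℕ) (b : Z → CGPow X l) (t : Z → I), Continuous b → Continuous t →
          Continuous fun z => F (t z) (word x₀ ⟨l, b z⟩) := by
      intro Z _ _ l b t hb ht
      refine continuous_fst.comp (continuous_wordAct_word hv hg hk hv0 hv1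
        hk1 hk0 hvc g.continuous hkc l b (fun i => (CGPow.continuous_apply i).comp hb)
        (fun z => (1, t z * L (word x₀ ⟨l, b z⟩))) ?_ fun _ _ => rfl)
      have h2 : Continuous fun z => L (word x₀ ⟨l, b z⟩) :=
        hL.comp (continuous_word.comp (continuous_sigmaMk.comp hb))
      exact continuous_const.prodMk ((continuous_subtype_val.comp ht).mul h2)
    have h1 := continuous_uncurry (CompHaus.of (ULift.{u} I)) (fun t w => F t.down w) fun l S b =>
      h0 _ (compactlyGeneratedSpace_of_compact_t2 (S × ULift.{u} I)) l (fun p => b p.1)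
        (fun p => p.2.down) (b.continuous.comp continuous_fst)
        (continuous_uliftDown.comp continuous_snd)
    exact h1.comp (f := fun p : I × James x₀ => (p.2, ULift.up p.1)) (by fun_prop)
  refine ⟨⟨_, continuous_antiLift hg g.continuous⟩, ⟨_, hF⟩, by simp, fun w => ?_, fun w => ?_,
    fun t => ?_⟩
  · simp only [ContinuousMap.coe_mk, F]
    rw [wordAct_of_nonpos hv hg hk hv1 _ _ (by simp), mul_one]
  · refine wordAct_fst_eq_one hv hg hk hv0 hv1 hk1 _ _ (fun _ => rfl) ?_
    rw [wordAct_snd]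
    simp [L]
  · simp [F, Function.End.one_def]

end James

end InverseMap

/-! ### Inverting classes and trivializing maps near a subset -/

section Killing

open unitInterval

variable {X : Type u} [TopologicalSpace X]

/-- A left inverse `χ` of the identity of `J(X)` up to a pointed homotopy `G`. -/
structure James.Inversion (x₀ : X) where
  χ : C(James x₀, James x₀)
  G : C(I × James x₀, James x₀)
  χ_one : χ 1 = 1
  G_zero : ∀ w, G (0, w) = χ w * w
  G_one : ∀ w, G (1, w) = 1
  G_base : ∀ t, G (t, 1) = 1

namespace James.Inversion

variable {x₀ : X} (D : James.Inversion x₀) {Z : Type u} [TopologicalSpace Z]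
  [CompactlyGeneratedSpace Z]

/-- The map `χ(g) f`, modified by a canonical homotopy where `u ≤ 1 / 2` and `f = g` so as to be
trivial where `u ≤ 0`. -/
noncomputable def kill (f g : C(Z, James x₀)) (u : C(Z, ℝ)) (h : ∀ z, u z ≤ 1 / 2 → f z = g z) :
    C(Z, James x₀) where
  toFun z := if u z ≤ 1 / 2 then D.G (Set.projIcc 0 1 zero_le_one (1 - 2 * u z), f z) else
    D.χ (g z) * f z
  continuous_toFun := by
    refine Continuous.if_le (by fun_prop) (continuous_mul (by fun_prop) (by fun_prop)) (by fun_prop)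
      continuous_const fun z hz => ?_
    rw [Set.projIcc_of_le_left _ (by rw [hz]; norm_num), ← h z hz.le]
    exact D.G_zero _

variable {f g : C(Z, James x₀)} {u : C(Z, ℝ)} (h : ∀ z, u z ≤ 1 / 2 → f z = g z)

theorem kill_apply (z : Z) : D.kill f g u h z =
    if u z ≤ 1 / 2 then D.G (Set.projIcc 0 1 zero_le_one (1 - 2 * u z), f z) else
      D.χ (g z) * f z := rfl

theorem kill_of_nonpos {z : Z} (hz : u z ≤ 0) : D.kill f g u h z = 1 := by
  rw [kill_apply, if_pos (by linarith), Set.projIcc_of_right_le _ (by linarith)]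
  exact D.G_one _

theorem kill_of_eq_one {z : Z} (hf : f z = 1) (hg : g z = 1) : D.kill f g u h z = 1 := by
  rw [kill_apply, hf, hg, D.G_base, D.χ_one, mul_one, ite_self]

/-- Scaling the time of G to 0 replaces it by χ(f) f, which is χ(g) f where u ≤ 1/2. -/
theorem kill_homotopicRel :
    (D.kill f g u h).HomotopicRel (mulMap (D.χ.comp g) f) {z | f z = 1 ∧ g z = 1} := by
  refine .of_map (fun p => if u p.2 ≤ 1 / 2 then
    D.G (σ p.1 * Set.projIcc 0 1 zero_le_one (1 - 2 * u p.2), f p.2) else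
      D.χ (g p.2) * f p.2) ?_ (fun z => ?_) (fun z => ?_) fun t z hz => ?_
  · refine Continuous.if_le (by fun_prop) (continuous_mul (by fun_prop) (by fun_prop)) (by fun_prop)
      continuous_const fun p hp => ?_
    rw [Set.projIcc_of_le_left _ (by rw [hp]; norm_num), ← h p.2 hp.le]
    refine Eq.trans ?_ (D.G_zero _)
    congr 2
    exact mul_zero _
  · simp [kill_apply]
  · by_cases hz : u z ≤ 1 / 2
    · simp only [symm_one, zero_mul]
      rw [if_pos hz, D.G_zero, h z hz]
      simp [mulMap, h z hz]
    · simp only [if_neg hz]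
      rfl
  · rw [D.kill_of_eq_one h hz.1 hz.2]
    simp only [hz.1, hz.2, D.G_base, D.χ_one, mul_one, ite_self]

theorem χ_mul_homotopicRel (f : C(Z, James x₀)) :
    (mulMap (D.χ.comp f) f).HomotopicRel (ContinuousMap.const Z 1) {z | f z = 1} := by
  refine .of_map (fun p => D.G (p.1, f p.2)) (by fun_prop) (fun z => D.G_zero _)
    (fun z => D.G_one _) fun t z hz => ?_
  rw [hz, D.G_base]
  simp [mulMap, hz.out, D.χ_one]

-- Postcomposition with χ gives left inverses, and a monoid in which every element has a left
-- inverse is a group.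
include D in
theorem isUnit {z₀ : Z} (a : HoClass z₀ (1 : James x₀)) : IsUnit a := by
  have hl : ∀ a : HoClass z₀ (1 : James x₀), ∃ b, b * a = 1 := by
    rintro ⟨f, hf⟩
    refine ⟨HoClass.mk (D.χ.comp f) (by simp [hf, D.χ_one]), Quotient.sound ?_⟩
    refine (D.χ_mul_homotopicRel f).mono ?_
    rintro z rfl
    exact hf
  obtain ⟨b, hb⟩ := hl a
  obtain ⟨c, hc⟩ := hl b
  have h1 : c = a := by rw [← mul_one c, ← hb, ← mul_assoc, hc, one_mul]
  exact ⟨⟨a, b, h1 ▸ hc, hb⟩, rfl⟩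

end James.Inversion

end Killing

/-! ### Deforming maps and null homotopies to be trivial on the fat wedge -/

section FatWedge

open unitInterval

variable {X : Type u} [TopologicalSpace X]

/-- The data of a nondegenerate base point: `h` deforms a neighbourhood of the base point. -/
structure NDRData (x₀ : X) where
  v : C(X, I)
  h : C(I × X, X)
  v_base : v x₀ = 0
  h_zero : ∀ x, h (0, x) = x
  h_base : ∀ t, h (t, x₀) = x₀
  h_one : ∀ x, v x < 1 → h (1, x) = x₀

variable {x₀ : X}

/-- The map to a power with given coordinates. -/
def CGPow.mkMap {Z : Type u} [TopologicalSpace Z] [CompactlyGeneratedSpace Z] {k : ℕ}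
    (f : Fin k → C(Z, X)) : C(Z, CGPow X k) :=
  ⟨fun z i => f i z, CGPow.continuous_of_apply _ fun i => (f i).continuous⟩

theorem CGPow.mkMap_apply {Z : Type u} [TopologicalSpace Z] [CompactlyGeneratedSpace Z] {k : ℕ}
    (f : Fin k → C(Z, X)) (z : Z) (i : Fin k) : CGPow.mkMap f z i = f i z := rfl

/-- The coordinate projections of a power. -/
def CGPow.coord {k : ℕ} (i : Fin k) : C(CGPow X k, X) := ⟨fun x => x i, CGPow.continuous_apply i⟩

/-- The deformation of a power of `X` induced by a deformation of `X`. -/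
def NDRData.pow (N : NDRData x₀) (k : ℕ) : C(I × CGPow X k, CGPow X k) :=
  CGPow.mkMap fun i => N.h.comp ⟨fun p => (p.1, CGPow.coord i p.2), by fun_prop⟩

/-- The end of the deformation `NDRData.pow`. -/
def NDRData.powOne (N : NDRData x₀) (k : ℕ) : C(CGPow X k, CGPow X k) :=
  (N.pow k).comp ⟨fun x => (1, x), by fun_prop⟩

theorem NDRData.powOne_apply (N : NDRData x₀) {k : ℕ} (x : CGPow X k) (i : Fin k) :
    N.powOne k x i = N.h (1, x i) := rfl

theorem NDRData.powOne_eq_base (N : NDRData x₀) {k : ℕ} {x : CGPow X k} {i : Fin k}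
    (hx : (N.v (x i) : ℝ) < 1) : N.powOne k x i = x₀ :=
  N.h_one _ (show N.v (x i) < 1 from hx)

theorem NDRData.powOne_of_base (N : NDRData x₀) {k : ℕ} {x : CGPow X k} {i : Fin k}
    (hx : x i = x₀) : N.powOne k x i = x₀ := by
  rw [powOne_apply, hx, N.h_base]

theorem NDRData.homotopicRel_comp_powOne (N : NDRData x₀) {k : ℕ} {Y : Type u} [TopologicalSpace Y]
    (f : C(CGPow X k, Y)) {S : Set (CGPow X k)}
    (hS : ∀ t, ∀ x ∈ S, f (N.pow k (t, x)) = f x) : f.HomotopicRel (f.comp (N.powOne k)) S := by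
  refine .of_map (fun p => f (N.pow k p)) (by fun_prop) (fun x => ?_) (fun x => rfl) hS
  congr 1
  exact funext fun i => N.h_zero _

/-- Replacing a coordinate by the base point. -/
def CGPow.erase (x₀ : X) {k : ℕ} (j : Fin k) : C(CGPow X k, CGPow X k) :=
  CGPow.mkMap fun i => if i = j then ContinuousMap.const _ x₀ else CGPow.coord i

theorem CGPow.erase_apply {k : ℕ} (j i : Fin k) (x : CGPow X k) :
    CGPow.erase x₀ j x i = if i = j then x₀ else x i := by
  rw [erase, mkMap_apply]
  split_ifs <;> rfl

theorem CGPow.erase_of_base {k : ℕ} {j i : Fin k} {x : CGPow X k} (hx : x i = x₀) :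
    CGPow.erase x₀ j x i = x₀ := by
  rw [erase_apply, hx, ite_self]

theorem CGPow.erase_eq_self {k : ℕ} {j : Fin k} {x : CGPow X k} (hx : x j = x₀) :
    CGPow.erase x₀ j x = x :=
  funext fun i => by
    rw [erase_apply]
    split_ifs with h
    · rw [h, hx]
    · rfl

section Wedges

variable {X : Type u} {x₀ : X}

/-- The tuples with a trivial coordinate among the first `j` ones. -/
def partialWedge (x₀ : X) (k j : ℕ) : Set (CGPow X k) := {x | ∃ i : Fin k, i.val < j ∧ x i = x₀}

/-- The fat wedge. -/
def fatWedge (x₀ : X) (k : ℕ) : Set (CGPow X k) := {x | ∃ i, x i = x₀}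

theorem partialWedge_succ {k : ℕ} (j : Fin k) {x : CGPow X k} (hx : x ∈ partialWedge x₀ k (j + 1)) :
    x ∈ partialWedge x₀ k j ∨ x j = x₀ := by
  obtain ⟨i, hi, hx⟩ := hx
  rcases Nat.lt_succ_iff_lt_or_eq.1 hi with h | h
  · exact Or.inl ⟨i, h, hx⟩
  · exact Or.inr (by rwa [← Fin.ext h])

theorem partialWedge_zero (k : ℕ) : partialWedge x₀ k 0 = ∅ := by
  ext x
  simp [partialWedge]

theorem partialWedge_self (k : ℕ) : partialWedge x₀ k k = fatWedge x₀ k := by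
  ext x
  simp [partialWedge, fatWedge]

end Wedges

variable (N : NDRData x₀) (D : James.Inversion x₀)

/-- The height function of the `j`-th coordinate. -/
def NDRData.height {k : ℕ} (j : Fin k) : C(CGPow X k, ℝ) :=
  ContinuousMap.comp ⟨fun t : I => (t : ℝ), continuous_subtype_val⟩ (N.v.comp (CGPow.coord j))

include N D in
/-- A pointed map on `X^k` which is null homotopic on every face is homotopic to a map which is
trivial on the fat wedge. -/
theorem exists_trivial_on_fatWedge {k : ℕ} (f : C(CGPow X k, James x₀))
    (hf : f (CGPow.base x₀ k) = 1)
    (h : ∀ j, (f.comp (CGPow.erase x₀ j)).HomotopicRel (ContinuousMap.const _ 1)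
      {CGPow.base x₀ k}) :
    ∃ Φ : C(CGPow X k, James x₀), (∀ x ∈ fatWedge x₀ k, Φ x = 1) ∧
      Φ.HomotopicRel f {CGPow.base x₀ k} := by
  suffices H : ∀ j ≤ k, ∃ Φ : C(CGPow X k, James x₀), (∀ x ∈ partialWedge x₀ k j, Φ x = 1) ∧
      Φ.HomotopicRel f {CGPow.base x₀ k} by
    simpa only [partialWedge_self] using H k le_rfl
  intro j
  induction j with
  | zero => exact fun _ => ⟨f, by simp [partialWedge_zero], .refl _⟩
  | succ j ih =>
    intro hj
    obtain ⟨Φ, hΦ, hΦf⟩ := ih (by omega)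
    let i : Fin k := ⟨j, hj⟩
    have hb : Φ (CGPow.base x₀ k) = 1 := (hΦf.fst_eq_snd rfl).trans hf
    have hpb : N.powOne k (CGPow.base x₀ k) = CGPow.base x₀ k :=
      funext fun i => N.powOne_of_base rfl
    have heb : CGPow.erase x₀ i (CGPow.base x₀ k) = CGPow.base x₀ k := CGPow.erase_eq_self rfl
    -- Near the i-th face the deformation lands on that face, so erasing the coordinate changes
    -- nothing. Dividing Φ by its null homotopic restriction to the face then makes it trivial
    -- there, and the previous faces stay trivial.
    have hu : ∀ x, N.height i x ≤ 1 / 2 → Φ.comp (N.powOne k) x =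
        (Φ.comp (CGPow.erase x₀ i)).comp (N.powOne k) x := fun x hx => by
      have : N.powOne k x i = x₀ := N.powOne_eq_base (lt_of_le_of_lt hx (by norm_num))
      simp [CGPow.erase_eq_self this]
    have h1 : ∀ x ∈ partialWedge x₀ k j, (Φ.comp (N.powOne k)) x = 1 := fun x ⟨i, hi, hx⟩ =>
      hΦ _ ⟨i, hi, N.powOne_of_base hx⟩
    have h2 : ∀ x ∈ partialWedge x₀ k j,
        ((Φ.comp (CGPow.erase x₀ i)).comp (N.powOne k)) x = 1 := fun x ⟨i, hi, hx⟩ =>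
      hΦ _ ⟨i, hi, CGPow.erase_of_base (N.powOne_of_base hx)⟩
    refine ⟨D.kill _ _ _ hu, fun x hx => ?_, ?_⟩
    · rcases partialWedge_succ i hx with hx | hx
      · exact D.kill_of_eq_one hu (h1 x hx) (h2 x hx)
      · refine D.kill_of_nonpos hu (le_of_eq ?_)
        change ((N.v (x i) : I) : ℝ) = 0
        rw [hx, N.v_base]
        rfl
    · refine ((D.kill_homotopicRel hu).mono ?_).trans (.trans (.trans
        (g := James.mulMap (ContinuousMap.const _ 1) Φ) ?_ ?_) hΦf)
      · rintro x rfl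
        exact ⟨by simp [hpb, hb], by simp [hpb, heb, hb]⟩
      · refine James.mulMap_homotopicRel ?_ (ContinuousMap.HomotopicRel.symm
          (N.homotopicRel_comp_powOne _ ?_))
        · have h3 : ((Φ.comp (CGPow.erase x₀ i)).comp (N.powOne k)).HomotopicRel
              (ContinuousMap.const _ 1) {CGPow.base x₀ k} := by
            refine ContinuousMap.HomotopicRel.trans (hΦf.comp_right
              ((CGPow.erase x₀ i).comp (N.powOne k)) ?_)
              ((h i).comp_right (N.powOne k) ?_)
            · rintro x rfl
              simp [hpb, heb]
            · rintro x rfl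
              simp [hpb]
          have h4 := h3.comp_continuousMap D.χ
          have h5 : D.χ.comp (ContinuousMap.const (CGPow X k) 1) = ContinuousMap.const _ 1 :=
            ContinuousMap.ext fun _ => D.χ_one
          rwa [h5] at h4
        · rintro t x rfl
          congr 1
          exact funext fun i => N.h_base t
      · have : James.mulMap (ContinuousMap.const _ 1) Φ = Φ := ContinuousMap.ext fun _ => one_mul _
        rw [this]
        exact .refl _

include N D in
/-- A map on `X^k` which is trivial on the fat wedge and freely null homotopic is null homotopic
relative to the fat wedge. -/
theorem homotopicRel_fatWedge {k : ℕ} (Φ : C(CGPow X k, James x₀))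
    (hΦ : ∀ x ∈ fatWedge x₀ k, Φ x = 1) (h : Φ.HomotopicRel (ContinuousMap.const _ 1) ∅) :
    Φ.HomotopicRel (ContinuousMap.const _ 1) (fatWedge x₀ k) := by
  suffices H : ∀ j ≤ k, Φ.HomotopicRel (ContinuousMap.const _ 1) (partialWedge x₀ k j) by
    simpa only [partialWedge_self] using H k le_rfl
  intro j
  induction j with
  | zero => exact fun _ => by rwa [partialWedge_zero]
  | succ j ih =>
    intro hj
    obtain ⟨K⟩ := ih (by omega)
    let i : Fin k := ⟨j, hj⟩
    have hsub : ∀ j, partialWedge x₀ k j ⊆ fatWedge x₀ k := fun j x ⟨i, _, hx⟩ => ⟨i, hx⟩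
    let e1 : C(I × CGPow X k, I × CGPow X k) := ⟨fun p => (p.1, N.powOne k p.2), by fun_prop⟩
    let e2 : C(I × CGPow X k, I × CGPow X k) :=
      ⟨fun p => (p.1, CGPow.erase x₀ i (N.powOne k p.2)), by fun_prop⟩
    let u : C(I × CGPow X k, ℝ) := (N.height i).comp ContinuousMap.snd
    have hi : ∀ x, N.height i x ≤ 1 / 2 → N.powOne k x i = x₀ := fun x hx =>
      N.powOne_eq_base (lt_of_le_of_lt hx (by norm_num))
    have hu : ∀ p, u p ≤ 1 / 2 → K.toContinuousMap.comp e1 p = K.toContinuousMap.comp e2 p :=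
      fun p hp => by simp [e1, e2, CGPow.erase_eq_self (hi p.2 hp)]
    have hu' : ∀ x, N.height i x ≤ 1 / 2 → (Φ.comp (N.powOne k)) x =
        (ContinuousMap.const (CGPow X k) (1 : James x₀)) x := fun x hx => hΦ _ ⟨i, hi x hx⟩
    have h1 : ∀ t, ∀ x ∈ partialWedge x₀ k j, K (t, x) = 1 := fun t x hx =>
      (K.eq_fst t hx).trans (hΦ x (hsub _ hx))
    have h2 : ∀ x, N.height i x ≤ 0 ↔ x i = x₀ ∨ N.height i x ≤ 0 := fun x => by
      refine ⟨Or.inr, fun h => h.elim (fun h => le_of_eq ?_) id⟩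
      change ((N.v (x i) : I) : ℝ) = 0
      rw [h, N.v_base]
      rfl
    -- The null homotopy K is itself divided by its restriction to the i-th face. At time 0 that
    -- restriction is 1, so the new homotopy starts at Φ ∘ `powOne` modified near the face, which is
    -- homotopic to Φ relative to the fat wedge.
    have h3 : (D.kill _ _ _ hu').HomotopicRel (ContinuousMap.const _ 1)
        (partialWedge x₀ k (j + 1)) := by
      have h4 : ∀ t, ∀ x ∈ partialWedge x₀ k (j + 1), D.kill _ _ _ hu (t, x) = 1 := by
        intro t x hx
        rcases partialWedge_succ i hx with ⟨l, hl, hx⟩ | hx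
        · exact D.kill_of_eq_one hu (h1 t _ ⟨l, hl, N.powOne_of_base hx⟩)
            (h1 t _ ⟨l, hl, CGPow.erase_of_base (N.powOne_of_base hx)⟩)
        · exact D.kill_of_nonpos hu ((h2 x).2 (Or.inl hx))
      refine .of_map (D.kill _ _ _ hu) (ContinuousMap.continuous _) (fun x => ?_) (fun x => ?_)
        fun t x hx => ?_
      · have h5 : K (0, N.powOne k x) = Φ (N.powOne k x) := K.apply_zero _
        have h6 : K (0, CGPow.erase x₀ i (N.powOne k x)) = 1 :=
          (K.apply_zero _).trans (hΦ _ ⟨i, by simp [CGPow.erase_apply]⟩)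
        rw [D.kill_apply, D.kill_apply]
        change (if N.height i x ≤ 1 / 2 then D.G (_, K (0, N.powOne k x)) else
          D.χ (K (0, CGPow.erase x₀ i (N.powOne k x))) * K (0, N.powOne k x)) = _
        rw [h5, h6]
        rfl
      · exact D.kill_of_eq_one hu (K.apply_one _) (K.apply_one _)
      · refine (h4 t x hx).trans (D.kill_of_eq_one hu' ?_ rfl).symm
        obtain ⟨l, -, hx⟩ := hx
        exact hΦ _ ⟨l, N.powOne_of_base hx⟩
    refine ContinuousMap.HomotopicRel.trans (ContinuousMap.HomotopicRel.mono ?_ (hsub _)) h3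
    refine ContinuousMap.HomotopicRel.symm (.trans ((D.kill_homotopicRel hu').mono ?_) ?_)
    · rintro x ⟨l, hx⟩
      exact ⟨hΦ _ ⟨l, N.powOne_of_base hx⟩, rfl⟩
    · have h7 : James.mulMap (D.χ.comp (ContinuousMap.const _ 1)) (Φ.comp (N.powOne k)) =
          Φ.comp (N.powOne k) := ContinuousMap.ext fun x => by simp [James.mulMap, D.χ_one]
      rw [h7]
      refine ContinuousMap.HomotopicRel.symm (N.homotopicRel_comp_powOne _ ?_)
      rintro t x ⟨l, hx⟩
      rw [hΦ x ⟨l, hx⟩]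
      refine hΦ _ ⟨l, ?_⟩
      change N.h (t, x l) = x₀
      rw [hx, N.h_base]

end FatWedge

/-! ### Products over subwords, reduced words and padding -/

section Words

variable {X : Type u} {M : Type*} [Monoid M]

/-- The combinatorial James–Hopf construction: the product of the values of `Φ` on all subwords of
length `k`, in a fixed order. -/
def hop : (k : ℕ) → ((Fin k → X) → M) → List X → M
  | 0, Φ, _ => Φ Fin.elim0
  | _ + 1, _, [] => 1
  | k + 1, Φ, y :: l => hop (k + 1) Φ l * hop k (fun a => Φ (Fin.cons y a)) l

theorem hop_one (k : ℕ) (l : List X) : hop k (fun _ => (1 : M)) l = 1 := by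
  induction l generalizing k with
  | nil => cases k <;> rfl
  | cons y l ih =>
    cases k with
    | zero => rfl
    | succ k => simp [hop, ih]

theorem hop_of_length_lt {k : ℕ} (Φ : (Fin k → X) → M) {l : List X} (h : l.length < k) :
    hop k Φ l = 1 := by
  induction l generalizing k with
  | nil =>
    cases k with
    | zero => simp at h
    | succ k => rfl
  | cons y l ih =>
    cases k with
    | zero => simp at h
    | succ k =>
      simp only [List.length_cons] at h
      rw [hop, ih _ (by omega), ih _ (by omega), one_mul]

theorem hop_ofFn {k : ℕ} (Φ : (Fin k → X) → M) (a : Fin k → X) : hop k Φ (List.ofFn a) = Φ a := by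
  induction k with
  | zero => exact congrArg Φ (Subsingleton.elim _ _)
  | succ k ih =>
    rw [List.ofFn_succ, hop, hop_of_length_lt _ (by simp), one_mul, ih]
    exact congrArg Φ (Fin.cons_self_tail a)

/-- Subwords using the inserted letter contribute 1, and the order of the remaining factors is
unchanged. -/
theorem hop_insert {x₀ : X} {k : ℕ} (Φ : (Fin k → X) → M) (hΦ : ∀ a, (∃ i, a i = x₀) → Φ a = 1)
    (l₁ l₂ : List X) : hop k Φ (l₁ ++ x₀ :: l₂) = hop k Φ (l₁ ++ l₂) := by
  induction l₁ generalizing k with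
  | nil =>
    cases k with
    | zero => simp [hop]
    | succ k =>
      have h : (fun a => Φ (Fin.cons x₀ a)) = fun _ => 1 := funext fun a => hΦ _ ⟨0, rfl⟩
      simp [hop, h, hop_one]
  | cons y l ih =>
    cases k with
    | zero => simp [hop]
    | succ k =>
      rw [List.cons_append, List.cons_append, hop, hop, ih Φ hΦ, ih]
      rintro a ⟨i, hi⟩
      exact hΦ _ ⟨i.succ, by simpa using hi⟩

open Classical in
/-- The word obtained by deleting the trivial letters. -/
noncomputable def reduced (x₀ : X) (l : List X) : List X := l.filter (· ≠ x₀)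

theorem reduced_cons_base (x₀ : X) (l : List X) : reduced x₀ (x₀ :: l) = reduced x₀ l := by
  simp [reduced]

theorem reduced_cons_of_ne {x₀ x : X} (h : x ≠ x₀) (l : List X) :
    reduced x₀ (x :: l) = x :: reduced x₀ l := by
  simp [reduced, h]

/-- A function of words which is insensitive to trivial letters depends on the reduced word. -/
theorem apply_reduced {x₀ : X} {Y : Type*} (n : ℕ) (f : List X → Y)
    (hf : ∀ l₁ l₂ : List X, l₁.length + l₂.length < n → f (l₁ ++ x₀ :: l₂) = f (l₁ ++ l₂))
    (p l : List X) (hl : p.length + l.length ≤ n) : f (p ++ reduced x₀ l) = f (p ++ l) := by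
  induction l generalizing p with
  | nil => rfl
  | cons y l ih =>
    simp only [List.length_cons] at hl
    by_cases hy : y = x₀
    · subst hy
      rw [reduced_cons_base, hf _ _ (by omega), ih _ (by omega)]
    · rw [reduced_cons_of_ne hy, ← List.singleton_append, ← List.append_assoc,
        ih (p ++ [y]) (by simp; omega)]
      simp

theorem hop_reduced {x₀ : X} {k : ℕ} (Φ : (Fin k → X) → M)
    (hΦ : ∀ a, (∃ i, a i = x₀) → Φ a = 1) (l : List X) :
    hop k Φ (reduced x₀ l) = hop k Φ l :=
  apply_reduced l.length (hop k Φ) (fun l₁ l₂ _ => hop_insert Φ hΦ l₁ l₂) [] l (by simp)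

theorem exists_ofFn_insertNth (x₀ : X) {n : ℕ} (j : Fin (n + 1)) (y : Fin n → X) :
    ∃ l₁ l₂ : List X, List.ofFn (Fin.insertNth (α := fun _ => X) j x₀ y) = l₁ ++ x₀ :: l₂ ∧
      List.ofFn y = l₁ ++ l₂ ∧ l₁.length = j := by
  induction n with
  | zero =>
    obtain rfl : j = 0 := Fin.ext (by omega)
    exact ⟨[], [], by simp, by simp, rfl⟩
  | succ n ih =>
    refine Fin.cases ?_ (fun j => ?_) j
    · exact ⟨[], List.ofFn y, by rw [Fin.insertNth_zero', List.ofFn_cons, List.nil_append], rfl, rfl⟩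
    · obtain ⟨l₁, l₂, h1, h2, h3⟩ := ih j (fun i => y i.succ)
      refine ⟨y 0 :: l₁, l₂, ?_, ?_, by simp [h3]⟩
      · rw [List.cons_append, ← h1, ← List.ofFn_cons, ← Fin.insertNth_succ_cons]
        congr 2
        exact (Fin.cons_self_tail y).symm
      · rw [List.ofFn_succ, h2, List.cons_append]

/-- The tuple of length `n` obtained by padding a word with base points. -/
def padWord (x₀ : X) (n : ℕ) (l : List X) : Fin n → X := fun i => l.getD i x₀

theorem padWord_ofFn (x₀ : X) {n : ℕ} (y : Fin n → X) : padWord x₀ n (List.ofFn y) = y := by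
  funext i
  simp [padWord, List.getD]

theorem padWord_insert (x₀ : X) {n : ℕ} (l₁ l₂ : List X) (h : l₁.length ≤ n) :
    padWord x₀ (n + 1) (l₁ ++ x₀ :: l₂) =
      Fin.insertNth (α := fun _ => X) ⟨l₁.length, Nat.lt_succ_of_le h⟩ x₀
        (padWord x₀ n (l₁ ++ l₂)) := by
  funext i
  generalize hj : (⟨l₁.length, Nat.lt_succ_of_le h⟩ : Fin (n + 1)) = j
  have hj' : j.val = l₁.length := by rw [← hj]
  refine Fin.succAboveCases (α := fun i => padWord x₀ (n + 1) (l₁ ++ x₀ :: l₂) i =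
      Fin.insertNth (α := fun _ => X) j x₀ (padWord x₀ n (l₁ ++ l₂)) i) j ?_ (fun i => ?_) i
  · rw [Fin.insertNth_apply_same]
    simp [padWord, List.getD, hj']
  · rw [Fin.insertNth_apply_succAbove]
    by_cases hi : i.val < l₁.length
    · rw [Fin.succAbove_of_castSucc_lt _ _ (by simpa [Fin.lt_def, hj'] using hi)]
      simp [padWord, List.getD, List.getElem?_append_left hi]
    · rw [Fin.succAbove_of_le_castSucc _ _ (by simpa [Fin.le_def, hj'] using hi)]
      have h1 : i.val + 1 - l₁.length = (i.val - l₁.length) + 1 := by omega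
      simp only [padWord, List.getD, Fin.val_succ]
      rw [List.getElem?_append_right (by omega), List.getElem?_append_right (by omega), h1,
        List.getElem?_cons_succ]

theorem padWord_eq_insertNth_last (x₀ : X) {n : ℕ} (l : List X) (h : l.length ≤ n) :
    padWord x₀ (n + 1) l =
      Fin.insertNth (α := fun _ => X) (Fin.last n) x₀ (padWord x₀ n l) := by
  funext i
  refine Fin.succAboveCases (α := fun i => padWord x₀ (n + 1) l i =
    Fin.insertNth (α := fun _ => X) (Fin.last n) x₀ (padWord x₀ n l) i) (Fin.last n) ?_
    (fun i => ?_) i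
  · rw [Fin.insertNth_apply_same]
    simp [padWord, List.getD, h]
  · rw [Fin.insertNth_apply_succAbove]
    simp [padWord]

theorem ofFn_padWord (x₀ : X) {n : ℕ} (l : List X) (h : l.length ≤ n) :
    List.ofFn (padWord x₀ n l) = l ++ List.replicate (n - l.length) x₀ := by
  refine List.ext_getElem (by simp; omega) fun i h1 h2 => ?_
  rw [List.getElem_ofFn, List.getElem_append]
  split_ifs with h3
  · simp [padWord, List.getD, h3]
  · simp [padWord, List.getD, not_lt.1 h3]

theorem reduced_ofFn_padWord (x₀ : X) {n : ℕ} (l : List X) (h : l.length ≤ n) :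
    reduced x₀ (List.ofFn (padWord x₀ n l)) = reduced x₀ l := by
  rw [ofFn_padWord x₀ l h]
  simp [reduced]

/-- Each letter that survives the collapse has height at least 1. Total height thereby controls word
length after the deformation. -/
theorem length_reduced_map_le {x₀ : X} (v : X → ℝ) (f : X → X) (hv : ∀ x, 0 ≤ v x)
    (hf : ∀ x, v x < 1 → f x = x₀) (l : List X) :
    ((reduced x₀ (l.map f)).length : ℝ) ≤ (l.map v).sum := by
  induction l with
  | nil => simp [reduced]
  | cons y l ih =>
    rw [List.map_cons, List.map_cons, List.sum_cons]
    by_cases h : f y = x₀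
    · rw [h, reduced_cons_base]
      linarith [hv y]
    · have h1 : 1 ≤ v y := not_lt.1 fun h1 => h (hf y h1)
      rw [reduced_cons_of_ne h, List.length_cons]
      push_cast
      linarith

theorem sum_le_length_reduced {x₀ : X} (v : X → ℝ) (hv : ∀ x, v x ≤ 1) (hv0 : v x₀ = 0)
    (l : List X) : (l.map v).sum ≤ (reduced x₀ l).length := by
  induction l with
  | nil => simp [reduced]
  | cons y l ih =>
    rw [List.map_cons, List.sum_cons]
    by_cases h : y = x₀
    · rw [h, hv0, reduced_cons_base]
      linarith
    · rw [reduced_cons_of_ne h, List.length_cons]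
      push_cast
      linarith [hv y]

theorem length_reduced_lt {x₀ : X} {k : ℕ} {a : Fin k → X} (h : ∃ i, a i = x₀) :
    (reduced x₀ (List.ofFn a)).length < k := by
  obtain ⟨i, hi⟩ := h
  exact lt_of_lt_of_eq (List.length_filter_lt_length_iff_exists.2 ⟨a i, by simp, by simp [hi]⟩)
    List.length_ofFn

end Words

/-! ### James–Hopf extensions over J_n(X) -/

section JamesHopf

open unitInterval

variable {X : Type u} [TopologicalSpace X] {x₀ : X}

/-- Φ is allowed to vary with z because the recursion absorbs the first letter into it; homotopies
of Φ are covered as well. -/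
theorem continuous_hop {Z : Type u} [TopologicalSpace Z] [CompactlyGeneratedSpace Z] {k n : ℕ}
    (Φ : Z → (Fin k → X) → James x₀)
    (hΦ : ∀ a : Fin k → Z → X, (∀ i, Continuous (a i)) → Continuous fun z => Φ z fun i => a i z)
    (b : Fin n → Z → X) (hb : ∀ i, Continuous (b i)) :
    Continuous fun z => hop k (Φ z) (List.ofFn fun i => b i z) := by
  induction n generalizing k with
  | zero =>
    cases k with
    | zero =>
      simp only [hop]
      have := hΦ Fin.elim0 fun i => i.elim0
      convert this using 2
      congr 1
      exact Subsingleton.elim _ _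
    | succ k => simpa [hop] using continuous_const
  | succ n ih =>
    cases k with
    | zero =>
      simp only [hop]
      have := hΦ Fin.elim0 fun i => i.elim0
      convert this using 2
      congr 1
      exact Subsingleton.elim _ _
    | succ k =>
      simp only [List.ofFn_succ, hop]
      refine James.continuous_mul (ih Φ hΦ (fun i => b i.succ) fun i => hb _)
        (ih (fun z a => Φ z (Fin.cons (b 0 z) a)) (fun a ha => ?_) (fun i => b i.succ) fun i => hb _)
      have h1 := hΦ (Fin.cons (b 0) a) (Fin.cases (hb 0) ha)
      convert h1 using 3 with z
      funext i
      exact Fin.cases rfl (fun i => rfl) i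

/-- Maps out of the James filtration. -/
def JamesFil.lift {n : ℕ} {Y : Type*} [TopologicalSpace Y] (f : C(CGPow X n, Y))
    (hf : ∀ a b, jamesFilRel x₀ n a b → f a = f b) : C(JamesFil x₀ n, Y) where
  toFun := Quot.lift f hf
  continuous_toFun := continuous_coinduced_dom.2 f.continuous

theorem JamesFil.isQuotientMap_q (n : ℕ) : IsQuotientMap (JamesFil.q x₀ n) :=
  isQuotientMap_quot_mk

theorem JamesFil.q_surjective (n : ℕ) : Function.Surjective (JamesFil.q x₀ n) :=
  Quot.mk_surjective

theorem JamesFil.q_incl {n : ℕ} (j k : Fin (n + 1)) (y : CGPow X n) :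
    JamesFil.q x₀ (n + 1) (CGPow.incl x₀ j y) = JamesFil.q x₀ (n + 1) (CGPow.incl x₀ k y) :=
  Quot.sound (.move j k y)

/-- Homotopies on the James filtration are constructed on powers of `X`. -/
theorem JamesFil.homotopicRel_of {n : ℕ} {Y : Type u} [TopologicalSpace Y]
    {f g : C(JamesFil x₀ n, Y)} (F : C(I × CGPow X n, Y))
    (hF : ∀ t a b, jamesFilRel x₀ n a b → F (t, a) = F (t, b))
    (h0 : ∀ y, F (0, y) = f (JamesFil.q x₀ n y)) (h1 : ∀ y, F (1, y) = g (JamesFil.q x₀ n y))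
    (hb : ∀ t, F (t, CGPow.base x₀ n) = f (JamesFil.base x₀ n)) :
    f.HomotopicRel g {JamesFil.base x₀ n} := by
  let F' : I × JamesFil x₀ n → Y := fun p => Quot.lift (fun y => F (p.1, y)) (hF p.1) p.2
  -- Multiplying the quotient map q by the locally compact space I again gives a quotient map.
  have hF' : Continuous F' :=
    (JamesFil.isQuotientMap_q n).continuous_lift_prod_right (g := F') F.continuous
  refine .of_map F' hF' ?_ ?_ ?_
  · rintro ⟨y⟩
    exact h0 y
  · rintro ⟨y⟩
    exact h1 y
  · rintro t _ rfl
    exact hb t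

/-- The word of coordinates of a tuple. -/
def CGPow.letters {n : ℕ} (y : CGPow X n) : List X := List.ofFn (n := n) (α := X) y

omit [TopologicalSpace X] in
theorem CGPow.length_letters {n : ℕ} (y : CGPow X n) : y.letters.length = n := List.length_ofFn

omit [TopologicalSpace X] in
theorem CGPow.exists_letters_incl {n : ℕ} (j : Fin (n + 1)) (y : CGPow X n) :
    ∃ l₁ l₂ : List X, (CGPow.incl x₀ j y).letters = l₁ ++ x₀ :: l₂ ∧
      y.letters = l₁ ++ l₂ ∧ l₁.length = j :=
  exists_ofFn_insertNth x₀ j y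

/-- The padding inclusion `X^k → X^n` by base points. -/
def CGPow.pad (x₀ : X) (k n : ℕ) : C(CGPow X k, CGPow X n) :=
  CGPow.mkMap fun i => if h : i.val < k then CGPow.coord ⟨i, h⟩ else ContinuousMap.const _ x₀

theorem CGPow.pad_eq (k n : ℕ) (y : CGPow X k) :
    CGPow.pad x₀ k n y = padWord x₀ n y.letters := by
  refine funext fun i => ?_
  rw [pad, mkMap_apply, padWord, List.getD]
  split_ifs with h
  · have h1 : y.letters[i.val]? = some (y ⟨i, h⟩) := by
      rw [List.getElem?_eq_getElem (by rwa [length_letters])]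
      exact congrArg some (List.getElem_ofFn (f := fun i : Fin k => y i) (by simpa using h))
    rw [h1]
    rfl
  · rw [List.getElem?_eq_none (by rw [length_letters]; omega)]
    rfl

theorem CGPow.pad_self (n : ℕ) (y : CGPow X n) : CGPow.pad x₀ n n y = y := by
  rw [pad_eq]
  exact padWord_ofFn x₀ y

theorem CGPow.pad_incl {k n : ℕ} (j : Fin (k + 1)) (hk : k ≤ n) (y : CGPow X k) :
    CGPow.pad x₀ (k + 1) (n + 1) (CGPow.incl x₀ j y) =
      CGPow.incl x₀ ⟨j, by omega⟩ (CGPow.pad x₀ k n y) := by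
  obtain ⟨l₁, l₂, h1, h2, h3⟩ := exists_letters_incl (x₀ := x₀) j y
  have h4 : (⟨j, by omega⟩ : Fin (n + 1)) = ⟨l₁.length, by omega⟩ := Fin.ext h3.symm
  rw [pad_eq, pad_eq, h1, h2, h4]
  exact padWord_insert x₀ l₁ l₂ (by omega)

/-- The map `J_n(X) → J(X)` induced by a map `X^k → J(X)` which is trivial on the fat wedge. -/
def hopMap (n : ℕ) {k : ℕ} (Φ : C(CGPow X k, James x₀)) (hΦ : ∀ x ∈ fatWedge x₀ k, Φ x = 1) :
    C(JamesFil x₀ n, James x₀) :=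
  JamesFil.lift ⟨fun y => hop k Φ y.letters,
    continuous_hop (fun _ => Φ) (fun a ha => Φ.continuous.comp
      (CGPow.mkMap fun i => ⟨a i, ha i⟩).continuous) (fun i (y : CGPow X n) => y i)
      CGPow.continuous_apply⟩ (by
    rintro _ _ ⟨i, j, y⟩
    obtain ⟨l₁, l₂, h1, h2, -⟩ := CGPow.exists_letters_incl (x₀ := x₀) i y
    obtain ⟨l₃, l₄, h3, h4, -⟩ := CGPow.exists_letters_incl (x₀ := x₀) j y
    change hop k Φ (CGPow.letters _) = hop k Φ (CGPow.letters _)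
    rw [h1, h3, hop_insert _ hΦ, hop_insert _ hΦ, ← h2, ← h4])

theorem hopMap_q (n : ℕ) {k : ℕ} (Φ : C(CGPow X k, James x₀))
    (hΦ : ∀ x ∈ fatWedge x₀ k, Φ x = 1) (y : CGPow X n) :
    hopMap n Φ hΦ (JamesFil.q x₀ n y) = hop k Φ y.letters := rfl

/-- The padding letters are invisible, and a word of length k has only one subword of length k. So
the extension restricts to Φ on X^k. -/
theorem hopMap_q_pad {n k : ℕ} (hk : k ≤ n) (Φ : C(CGPow X k, James x₀))
    (hΦ : ∀ x ∈ fatWedge x₀ k, Φ x = 1) (y : CGPow X k) :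
    hopMap n Φ hΦ (JamesFil.q x₀ n (CGPow.pad x₀ k n y)) = Φ y := by
  rw [hopMap_q, CGPow.pad_eq]
  have h1 := hop_reduced (x₀ := x₀) Φ hΦ (List.ofFn (padWord x₀ n y.letters))
  rw [reduced_ofFn_padWord x₀ _ (by rwa [CGPow.length_letters]), hop_reduced _ hΦ] at h1
  exact h1.symm.trans (hop_ofFn _ _)

theorem hopMap_base (n : ℕ) {k : ℕ} (hk : k ≠ 0) (Φ : C(CGPow X k, James x₀))
    (hΦ : ∀ x ∈ fatWedge x₀ k, Φ x = 1) : hopMap n Φ hΦ (JamesFil.base x₀ n) = 1 := by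
  change hop k Φ (List.ofFn fun _ : Fin n => x₀) = 1
  rw [← hop_reduced (x₀ := x₀) Φ hΦ]
  refine hop_of_length_lt _ ?_
  simpa [reduced] using Nat.pos_of_ne_zero hk

/-- Every stage of a homotopy relative to the fat wedge is trivial there and so extends over J_n(X).
A merely pointed null homotopy would not suffice. -/
theorem hopMap_homotopicRel_one (n : ℕ) {k : ℕ} (hk : k ≠ 0) (Φ : C(CGPow X k, James x₀))
    (hΦ : ∀ x ∈ fatWedge x₀ k, Φ x = 1)
    (h : Φ.HomotopicRel (ContinuousMap.const _ 1) (fatWedge x₀ k)) :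
    (hopMap n Φ hΦ).HomotopicRel (ContinuousMap.const _ 1) {JamesFil.base x₀ n} := by
  obtain ⟨K⟩ := h
  have hK : ∀ t, ∀ x ∈ fatWedge x₀ k, K (t, x) = 1 := fun t x hx => (K.eq_fst t hx).trans (hΦ x hx)
  refine JamesFil.homotopicRel_of
    ⟨fun p => hop k (fun a : CGPow X k => K (p.1, a)) p.2.letters, ?_⟩ ?_
    (fun y => ?_) (fun y => ?_) fun t => ?_
  · refine continuous_hop (Z := I × CGPow X n) (fun p (a : CGPow X k) => K (p.1, a)) (fun a ha => ?_)
      (fun i p => p.2 i) fun i => (CGPow.continuous_apply i).comp continuous_snd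
    have := (CGPow.mkMap fun i => ⟨a i, ha i⟩).continuous
    exact K.continuous.comp (continuous_fst.prodMk this)
  · rintro t _ _ hab
    exact congrArg (hopMap n (⟨fun a => K (t, a), by fun_prop⟩ : C(CGPow X k, James x₀)) (hK t))
      (Quot.sound hab)
  · have : (fun a : CGPow X k => K (0, a)) = Φ := funext fun a => K.apply_zero a
    rw [hopMap_q]
    exact congrArg (fun Ψ : (Fin k → X) → James x₀ => hop k Ψ y.letters) this
  · have : (fun a : CGPow X k => K (1, a)) = fun _ => 1 := funext fun a => K.apply_one a
    exact (congrArg (fun Ψ : (Fin k → X) → James x₀ => hop k Ψ y.letters) this).trans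
      (hop_one k _)
  · rw [hopMap_base n hk]
    exact hopMap_base n hk (⟨fun a => K (t, a), by fun_prop⟩ : C(CGPow X k, James x₀)) (hK t)

end JamesHopf

/-! ### Injectivity of q_n^* -/

section Injectivity

open unitInterval

variable {X : Type u} [TopologicalSpace X] {x₀ : X} (N : NDRData x₀) (D : James.Inversion x₀)

omit [TopologicalSpace X] in
theorem CGPow.incl_same {n : ℕ} (j : Fin (n + 1)) (y : CGPow X n) : CGPow.incl x₀ j y j = x₀ :=
  Fin.insertNth_apply_same (α := fun _ => X) j x₀ y

omit [TopologicalSpace X] in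
theorem CGPow.incl_succAbove {n : ℕ} (j : Fin (n + 1)) (y : CGPow X n) (i : Fin n) :
    CGPow.incl x₀ j y (j.succAbove i) = y i :=
  Fin.insertNth_apply_succAbove (α := fun _ => X) j x₀ y i

theorem NDRData.pow_incl {n : ℕ} (t : I) (j : Fin (n + 1)) (y : CGPow X n) :
    N.pow (n + 1) (t, CGPow.incl x₀ j y) = CGPow.incl x₀ j (N.pow n (t, y)) := by
  refine funext fun i => ?_
  change N.h (t, CGPow.incl x₀ j y i) = _
  obtain rfl | hi := eq_or_ne i j
  · rw [CGPow.incl_same, CGPow.incl_same, N.h_base]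
  · obtain ⟨i, rfl⟩ := Fin.exists_succAbove_eq hi
    rw [CGPow.incl_succAbove, CGPow.incl_succAbove]
    rfl

theorem NDRData.q_pow_eq {n : ℕ} (t : I) (a b : CGPow X n) (h : jamesFilRel x₀ n a b) :
    JamesFil.q x₀ n (N.pow n (t, a)) = JamesFil.q x₀ n (N.pow n (t, b)) := by
  obtain ⟨i, j, y⟩ := h
  rw [N.pow_incl, N.pow_incl, JamesFil.q_incl]

theorem NDRData.pow_base {n : ℕ} (t : I) : N.pow n (t, CGPow.base x₀ n) = CGPow.base x₀ n :=
  funext fun _ => N.h_base t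

/-- The end of the deformation of the James filtration induced by a deformation of `X`. -/
def NDRData.filOne (n : ℕ) : C(JamesFil x₀ n, JamesFil x₀ n) :=
  JamesFil.lift ((JamesFil.q x₀ n).comp (N.powOne n)) (N.q_pow_eq 1)

theorem NDRData.filOne_q {n : ℕ} (y : CGPow X n) :
    N.filOne n (JamesFil.q x₀ n y) = JamesFil.q x₀ n (N.powOne n y) := rfl

theorem NDRData.filOne_base (n : ℕ) : N.filOne n (JamesFil.base x₀ n) = JamesFil.base x₀ n :=
  congrArg _ (N.pow_base 1)

theorem NDRData.homotopicRel_comp_filOne {n : ℕ} {Y : Type u} [TopologicalSpace Y]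
    (f : C(JamesFil x₀ n, Y)) : f.HomotopicRel (f.comp (N.filOne n)) {JamesFil.base x₀ n} := by
  refine JamesFil.homotopicRel_of ((f.comp (JamesFil.q x₀ n)).comp (N.pow n))
    (fun t a b h => congrArg f (N.q_pow_eq t a b h)) (fun y => ?_) (fun y => rfl) fun t => ?_
  · exact congrArg (fun z => f (JamesFil.q x₀ n z)) (funext fun i => N.h_zero _)
  · exact congrArg (fun z => f (JamesFil.q x₀ n z)) (N.pow_base t)

/-- The sum of the heights of all coordinates. -/
def NDRData.totalHeight (n : ℕ) : C(JamesFil x₀ n, ℝ) :=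
  JamesFil.lift ⟨fun y => (y.letters.map fun x => (N.v x : ℝ)).sum, by
    have h : (fun y : CGPow X n => (y.letters.map fun x => (N.v x : ℝ)).sum) =
        fun y => ∑ i, N.height i y := funext fun y =>
      (congrArg List.sum (List.map_ofFn (f := fun i => y i) (g := fun x => (N.v x : ℝ)))).trans
        List.sum_ofFn
    rw [h]
    exact continuous_finsetSum _ fun i _ => (N.height i).continuous⟩ (by
    rintro _ _ ⟨i, j, y⟩
    obtain ⟨l₁, l₂, h1, h2, -⟩ := CGPow.exists_letters_incl (x₀ := x₀) i y
    obtain ⟨l₃, l₄, h3, h4, -⟩ := CGPow.exists_letters_incl (x₀ := x₀) j y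
    have h5 := congrArg (fun l => (l.map fun x => (N.v x : ℝ)).sum) (h2.symm.trans h4)
    simp only [List.map_append, List.sum_append] at h5
    simp [h1, h3, N.v_base, h5])

theorem NDRData.letters_powOne {n : ℕ} (y : CGPow X n) :
    (N.powOne n y).letters = y.letters.map fun x => N.h (1, x) :=
  (List.map_ofFn (f := fun i => y i) (g := fun x => N.h (1, x))).symm

/-- Moving trivial letters to the end is exactly what the identifications defining J_n(X) permit. -/
theorem JamesFil.q_padWord_reduced {n : ℕ} (y : CGPow X n) :
    JamesFil.q x₀ n (padWord x₀ n (reduced x₀ y.letters)) = JamesFil.q x₀ n y := by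
  have h := apply_reduced (x₀ := x₀) n (fun l => JamesFil.q x₀ n (padWord x₀ n l)) ?_ [] y.letters
    (by simp [CGPow.length_letters])
  · simp only [List.nil_append] at h
    exact h.trans (congrArg _ (padWord_ofFn x₀ y))
  · intro l₁ l₂ hl
    obtain _ | n := n
    · omega
    · have h1 := padWord_insert x₀ (n := n) l₁ l₂ (by omega)
      have h2 := padWord_eq_insertNth_last x₀ (n := n) (l₁ ++ l₂) (by simp; omega)
      exact (congrArg _ h1).trans ((JamesFil.q_incl _ _ _).trans (congrArg _ h2.symm))

/-- A map on `J_n(X)` which is trivial on words of length less than `k` agrees on words of length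
at most `k` with the combinatorial James–Hopf extension of its restriction to `X^k`. -/
theorem eq_hopMap {n k : ℕ} (b : C(JamesFil x₀ n, James x₀)) (Φ : C(CGPow X (k + 1), James x₀))
    (hΦb : ∀ y, Φ y = b (JamesFil.q x₀ n (CGPow.pad x₀ (k + 1) n y)))
    (hΦ : ∀ x ∈ fatWedge x₀ (k + 1), Φ x = 1)
    (hb : ∀ y : CGPow X n, (reduced x₀ y.letters).length ≤ k → b (JamesFil.q x₀ n y) = 1)
    (y : CGPow X n) (hy : (reduced x₀ y.letters).length ≤ k + 1) :
    b (JamesFil.q x₀ n y) = hopMap n Φ hΦ (JamesFil.q x₀ n y) := by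
  rw [hopMap_q]
  refine Eq.trans ?_ (hop_reduced (x₀ := x₀) Φ hΦ y.letters)
  rcases Nat.lt_or_eq_of_le hy with h | h
  · exact (hb y (by omega)).trans (hop_of_length_lt _ h).symm
  · rw [← JamesFil.q_padWord_reduced]
    generalize reduced x₀ y.letters = r at h
    obtain ⟨a, rfl⟩ : ∃ a : Fin (k + 1) → X, r = List.ofFn a :=
      ⟨_, (List.ofFn_get r).symm.trans (List.ofFn_congr h _)⟩
    refine Eq.trans ?_ (hop_ofFn _ _).symm
    refine Eq.trans ?_ (hΦb a).symm
    exact congrArg (fun z => b (JamesFil.q x₀ n z)) (CGPow.pad_eq _ _ _).symm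

-- The restriction Φ of b to X^{k+1} is trivial on the fat wedge and null homotopic, hence null
-- homotopic relative to the fat wedge, so its extension `hopMap` is null homotopic. As b agrees
-- with that extension on words of length at most k + 1, dividing by it trivializes b there without
-- changing its class.
include N D in
theorem exists_trivial_on_longer_words {n k : ℕ} (hk : k < n) (b : C(JamesFil x₀ n, James x₀))
    (hq : (b.comp (JamesFil.q x₀ n)).HomotopicRel (ContinuousMap.const _ 1) {CGPow.base x₀ n})
    (hb : ∀ y : CGPow X n, (reduced x₀ y.letters).length ≤ k → b (JamesFil.q x₀ n y) = 1) :
    ∃ b' : C(JamesFil x₀ n, James x₀), b'.HomotopicRel b {JamesFil.base x₀ n} ∧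
      ∀ y : CGPow X n, (reduced x₀ y.letters).length ≤ k + 1 → b' (JamesFil.q x₀ n y) = 1 := by
  let Φ : C(CGPow X (k + 1), James x₀) := (b.comp (JamesFil.q x₀ n)).comp (CGPow.pad x₀ (k + 1) n)
  have hΦ : ∀ x ∈ fatWedge x₀ (k + 1), Φ x = 1 := fun x hx => by
    refine hb _ ?_
    rw [CGPow.pad_eq]
    refine Nat.lt_succ_iff.1 (lt_of_eq_of_lt ?_ (length_reduced_lt hx))
    exact congrArg List.length (reduced_ofFn_padWord x₀ _ (by rw [CGPow.length_letters]; omega))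
  have h0 : Φ.HomotopicRel (ContinuousMap.const _ 1) ∅ :=
    hq.comp_right (CGPow.pad x₀ (k + 1) n) (T := ∅) (by simp [Set.MapsTo])
  have hg := hopMap_homotopicRel_one n k.succ_ne_zero Φ hΦ (homotopicRel_fatWedge N D Φ hΦ h0)
  have hfg := eq_hopMap b Φ (fun _ => rfl) hΦ hb
  -- Heights are at most 1, so u ≤ 0 on words of length at most k + 1. Where u ≤ 1/2 the deformation
  -- leaves at most k + 3/2 < k + 2 letters, hence at most k + 1.
  let u : C(JamesFil x₀ n, ℝ) := N.totalHeight n - ContinuousMap.const _ (k + 1 : ℝ)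
  have hu : ∀ z, u z ≤ 1 / 2 → b.comp (N.filOne n) z = (hopMap n Φ hΦ).comp (N.filOne n) z := by
    intro z hz
    obtain ⟨y, rfl⟩ := JamesFil.q_surjective n z
    rw [ContinuousMap.comp_apply, ContinuousMap.comp_apply, N.filOne_q]
    refine hfg _ ?_
    rw [N.letters_powOne]
    have h1 := length_reduced_map_le (x₀ := x₀) (fun x => (N.v x : ℝ)) (fun x => N.h (1, x))
      (fun x => (N.v x).2.1) N.h_one y.letters
    have h2 : (y.letters.map fun x => (N.v x : ℝ)).sum - (k + 1) ≤ 1 / 2 := hz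
    have h3 : ((reduced x₀ (y.letters.map fun x => N.h (1, x))).length : ℝ) <
        ((k + 2 : ℕ) : ℝ) := by push_cast; linarith
    exact Nat.lt_succ_iff.1 (Nat.cast_lt.1 h3)
  have hbb : b (JamesFil.base x₀ n) = 1 := hq.fst_eq_snd rfl
  refine ⟨D.kill _ _ u hu, ?_, fun y hy => D.kill_of_nonpos hu ?_⟩
  · refine ((D.kill_homotopicRel hu).mono ?_).trans (.trans
      (g := James.mulMap (ContinuousMap.const _ 1) b) (James.mulMap_homotopicRel ?_
        (N.homotopicRel_comp_filOne b).symm) ?_)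
    · rintro z rfl
      simp [N.filOne_base, hbb, hopMap_base]
    · have h4 := (hg.comp_right (N.filOne n) (T := {JamesFil.base x₀ n}) (by
        rintro z rfl
        exact N.filOne_base n)).comp_continuousMap D.χ
      have h5 : D.χ.comp ((ContinuousMap.const (JamesFil x₀ n) 1).comp (N.filOne n)) =
        ContinuousMap.const _ 1 := ContinuousMap.ext fun _ => D.χ_one
      rwa [h5] at h4
    · have : James.mulMap (ContinuousMap.const _ 1) b = b := ContinuousMap.ext fun _ => one_mul _
      rw [this]
      exact .refl _
  · have h1 := sum_le_length_reduced (x₀ := x₀) (fun x => (N.v x : ℝ)) (fun x => (N.v x).2.2)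
      (by simp [N.v_base]) y.letters
    have h2 : ((reduced x₀ y.letters).length : ℝ) ≤ ((k + 1 : ℕ) : ℝ) := Nat.cast_le.2 hy
    push_cast at h2
    change (y.letters.map fun x => (N.v x : ℝ)).sum - (k + 1) ≤ 0
    linarith

-- Raising the trivial word length from 0 to n replaces b, within its homotopy class, by the
-- constant map.
include N D in
theorem homotopicRel_one_of_comp_q {n : ℕ} (b : C(JamesFil x₀ n, James x₀))
    (hq : (b.comp (JamesFil.q x₀ n)).HomotopicRel (ContinuousMap.const _ 1) {CGPow.base x₀ n}) :
    b.HomotopicRel (ContinuousMap.const _ 1) {JamesFil.base x₀ n} := by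
  have H : ∀ k ≤ n, ∃ b' : C(JamesFil x₀ n, James x₀), b'.HomotopicRel b {JamesFil.base x₀ n} ∧
      ∀ y : CGPow X n, (reduced x₀ y.letters).length ≤ k → b' (JamesFil.q x₀ n y) = 1 := by
    intro k
    induction k with
    | zero =>
      refine fun _ => ⟨b, .refl _, fun y hy => ?_⟩
      rw [← JamesFil.q_padWord_reduced, List.length_eq_zero_iff.1 (Nat.le_zero.1 hy)]
      exact hq.fst_eq_snd (x := CGPow.base x₀ n) rfl
    | succ k ih =>
      intro hk
      obtain ⟨b₁, h1, h2⟩ := ih (by omega)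
      obtain ⟨b₂, h3, h4⟩ := exists_trivial_on_longer_words N D hk b₁
        ((h1.comp_right (JamesFil.q x₀ n) (by rintro _ rfl; rfl)).trans hq) h2
      exact ⟨b₂, h3.trans h1, h4⟩
  obtain ⟨b', h1, h2⟩ := H n le_rfl
  have h3 : b' = ContinuousMap.const _ 1 := ContinuousMap.ext fun z => by
    obtain ⟨y, rfl⟩ := JamesFil.q_surjective n z
    refine h2 y ((List.length_filter_le _ _).trans (CGPow.length_letters y).le)
  exact h3 ▸ h1.symm

include N D in
theorem qStar_injective (n : ℕ) : Function.Injective (qStar x₀ n) := by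
  have H : ∀ β, qStar x₀ n β = 1 → β = 1 := by
    rintro ⟨b, hb⟩ h
    exact Quotient.sound (homotopicRel_one_of_comp_q N D b (Quotient.exact h))
  intro a b hab
  obtain ⟨a, rfl⟩ := D.isUnit a
  have h1 : (↑a⁻¹ : HoClass (JamesFil.base x₀ n) (1 : James x₀)) * b = 1 :=
    H _ (by rw [map_mul, ← hab, ← map_mul, Units.inv_mul, map_one])
  rw [← a.mul_right_inj (c := b)] at *
  rw [← mul_one (a : HoClass (JamesFil.base x₀ n) (1 : James x₀)), ← h1, Units.mul_inv_cancel_left]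

end Injectivity

/-! ### Functoriality of precomposition -/

section Precomp

variable {X : Type u} [TopologicalSpace X] {x₀ : X}
  {Z Y W : Type u} [TopologicalSpace Z] [CompactlyGeneratedSpace Z]
  [TopologicalSpace Y] [CompactlyGeneratedSpace Y] [TopologicalSpace W] [CompactlyGeneratedSpace W]

theorem HoClass.precomp_precomp {z₀ : Z} {y₀ : Y} {w₀ : W} (q : C(Z, Y)) (hq : q z₀ = y₀)
    (r : C(Y, W)) (hr : r y₀ = w₀) (s : C(Z, W)) (hs : s z₀ = w₀) (h : ∀ z, s z = r (q z))
    (a : HoClass w₀ (1 : James x₀)) :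
    HoClass.precomp q hq (HoClass.precomp r hr a) = HoClass.precomp s hs a := by
  obtain rfl : s = r.comp q := ContinuousMap.ext h
  obtain ⟨a⟩ := a
  rfl

theorem HoClass.precomp_eq_self {z₀ : Z} (q : C(Z, Z)) (hq : q z₀ = z₀) (h : ∀ z, q z = z)
    (a : HoClass z₀ (1 : James x₀)) : HoClass.precomp q hq a = a := by
  obtain rfl : q = ContinuousMap.id Z := ContinuousMap.ext h
  obtain ⟨a⟩ := a
  rfl

end Precomp

/-! ### Classes with equal faces descend to J_n(X) -/

section Surjectivity

variable {X : Type u} [TopologicalSpace X] {x₀ : X}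

omit [TopologicalSpace X] in
theorem CGPow.incl_base {n : ℕ} (j : Fin (n + 1)) :
    CGPow.incl x₀ j (CGPow.base x₀ n) = CGPow.base x₀ (n + 1) := by
  refine funext fun i => ?_
  obtain rfl | hi := eq_or_ne i j
  · rw [CGPow.incl_same]
    rfl
  · obtain ⟨i, rfl⟩ := Fin.exists_succAbove_eq hi
    rw [CGPow.incl_succAbove]
    rfl

/-- The inclusion `X^n → X^{n+1}` inserting a base point as a continuous map. -/
def CGPow.inclMap (x₀ : X) {n : ℕ} (j : Fin (n + 1)) : C(CGPow X n, CGPow X (n + 1)) where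
  toFun := CGPow.incl x₀ j
  continuous_toFun := CGPow.continuous_of_apply _ fun i => by
    obtain rfl | hi := eq_or_ne i j
    · simp only [CGPow.incl_same]
      exact continuous_const
    · obtain ⟨i, rfl⟩ := Fin.exists_succAbove_eq hi
      simp only [CGPow.incl_succAbove]
      exact CGPow.continuous_apply i

/-- The `j`-th face map `[X^{n+1}, J(X)] → [X^n, J(X)]`. -/
def HoClass.face (x₀ : X) {n : ℕ} (j : Fin (n + 1)) :
    HoClass (CGPow.base x₀ (n + 1)) (1 : James x₀) →* HoClass (CGPow.base x₀ n) (1 : James x₀) :=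
  HoClass.precomp (CGPow.inclMap x₀ j) (CGPow.incl_base j)

theorem CGPow.erase_base {k : ℕ} (j : Fin k) :
    CGPow.erase x₀ j (CGPow.base x₀ k) = CGPow.base x₀ k := CGPow.erase_eq_self rfl

theorem CGPow.pad_base (k n : ℕ) : CGPow.pad x₀ k n (CGPow.base x₀ k) = CGPow.base x₀ n :=
  funext fun i => by
    rw [CGPow.pad, CGPow.mkMap_apply]
    split_ifs <;> rfl

/-- Forgetting a coordinate. -/
def CGPow.forget (X : Type u) [TopologicalSpace X] {k : ℕ} (j : Fin (k + 1)) :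
    C(CGPow X (k + 1), CGPow X k) :=
  CGPow.mkMap fun i => CGPow.coord (j.succAbove i)

theorem CGPow.forget_base {k : ℕ} (j : Fin (k + 1)) :
    CGPow.forget X j (CGPow.base x₀ (k + 1)) = CGPow.base x₀ k := rfl

theorem CGPow.erase_eq_incl_forget {k : ℕ} (j : Fin (k + 1)) (y : CGPow X (k + 1)) :
    CGPow.erase x₀ j y = CGPow.incl x₀ j (CGPow.forget X j y) := by
  refine funext fun i => ?_
  rw [CGPow.erase_apply]
  obtain rfl | hi := eq_or_ne i j
  · rw [if_pos rfl, CGPow.incl_same]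
  · rw [if_neg hi]
    obtain ⟨i, rfl⟩ := Fin.exists_succAbove_eq hi
    rw [CGPow.incl_succAbove]
    rfl

theorem HoClass.precomp_erase {k : ℕ} (j : Fin (k + 1))
    (a : HoClass (CGPow.base x₀ (k + 1)) (1 : James x₀)) :
    HoClass.precomp (CGPow.erase x₀ j) (CGPow.erase_base j) a =
      HoClass.precomp (CGPow.forget X j) (CGPow.forget_base j) (HoClass.face x₀ j a) :=
  (HoClass.precomp_precomp _ _ _ _ _ _ (fun y => CGPow.erase_eq_incl_forget j y) a).symm

theorem HoClass.face_qStar {n : ℕ} (i j : Fin (n + 1))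
    (b : HoClass (JamesFil.base x₀ (n + 1)) (1 : James x₀)) :
    HoClass.face x₀ i (qStar x₀ (n + 1) b) = HoClass.face x₀ j (qStar x₀ (n + 1) b) :=
  (HoClass.precomp_precomp (CGPow.inclMap x₀ i) (CGPow.incl_base i) _ _
    ((JamesFil.q x₀ (n + 1)).comp (CGPow.inclMap x₀ i))
      (congrArg (JamesFil.q x₀ (n + 1)) (CGPow.incl_base i))
      (fun _ => rfl) b).trans
    (HoClass.precomp_precomp (CGPow.inclMap x₀ j) (CGPow.incl_base j) _ _ _ _
      (fun y => JamesFil.q_incl i j y) b).symm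

/-- Restriction along the padding inclusion. -/
def HoClass.padStar (x₀ : X) (k n : ℕ) :
    HoClass (CGPow.base x₀ n) (1 : James x₀) →* HoClass (CGPow.base x₀ k) (1 : James x₀) :=
  HoClass.precomp (CGPow.pad x₀ k n) (CGPow.pad_base k n)

theorem CGPow.pad_base_incl_last {k n : ℕ} (hk : k ≤ n) (y : CGPow X k) :
    CGPow.pad x₀ k (n + 1) y = CGPow.incl x₀ (Fin.last n) (CGPow.pad x₀ k n y) := by
  rw [CGPow.pad_eq, CGPow.pad_eq]
  exact padWord_eq_insertNth_last x₀ _ (by rwa [CGPow.length_letters])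

/-- Inserting a base point and then padding is padding followed by an insertion. Equality of the
faces moves that insertion to the last place, where it is itself padding. -/
theorem HoClass.face_padStar {k m : ℕ} (hk : k ≤ m) (j : Fin (k + 1))
    (a : HoClass (CGPow.base x₀ (m + 1)) (1 : James x₀))
    (ha : ∀ i j, HoClass.face x₀ i a = HoClass.face x₀ j a) :
    HoClass.face x₀ j (HoClass.padStar x₀ (k + 1) (m + 1) a) = HoClass.padStar x₀ k (m + 1) a := by
  have h1 : HoClass.face x₀ j (HoClass.padStar x₀ (k + 1) (m + 1) a) =
      HoClass.padStar x₀ k m (HoClass.face x₀ ⟨j, by omega⟩ a) :=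
    (HoClass.precomp_precomp _ _ _ _ ((CGPow.pad x₀ (k + 1) (m + 1)).comp (CGPow.inclMap x₀ j))
      ((congrArg _ (CGPow.incl_base j)).trans (CGPow.pad_base _ _)) (fun _ => rfl) a).trans
    (HoClass.precomp_precomp _ _ _ _ _ _ (fun y => CGPow.pad_incl j hk y) a).symm
  rw [h1, ha _ (Fin.last m)]
  exact HoClass.precomp_precomp _ _ _ _ _ _ (fun y => CGPow.pad_base_incl_last hk y) a

variable (N : NDRData x₀) (D : James.Inversion x₀)

include N D in
/-- A class in `[X^k, J(X)]` which is trivial on every face is represented by a map which is trivial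
on the fat wedge. -/
theorem HoClass.exists_rep_trivial_on_fatWedge {k : ℕ}
    (a : HoClass (CGPow.base x₀ k) (1 : James x₀))
    (ha : ∀ j, HoClass.precomp (CGPow.erase x₀ j) (CGPow.erase_base j) a = 1) :
    ∃ (Φ : C(CGPow X k, James x₀)) (hb : Φ (CGPow.base x₀ k) = 1),
      (∀ x ∈ fatWedge x₀ k, Φ x = 1) ∧ HoClass.mk Φ hb = a := by
  obtain ⟨f, hf⟩ := a
  obtain ⟨Φ, h1, h2⟩ := exists_trivial_on_fatWedge N D f hf fun j => Quotient.exact (ha j)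
  exact ⟨Φ, (h2.fst_eq_snd rfl).trans hf, h1, Quotient.sound h2⟩

-- On X^{k+1} the faces of a restrict to its trivial restriction to X^k, so a is represented there
-- by a map trivial on the fat wedge. Its extension over J_{m+1}(X) gives a class b agreeing with a
-- on X^{k+1}; a · q^*(b)⁻¹ still has equal faces and is trivial on X^{k+1}, and the induction
-- continues until k = m + 1.
include N D in
theorem exists_qStar_eq_of_padStar_eq_one {m : ℕ} (d k : ℕ) (hd : k + d = m + 1)
    (a : HoClass (CGPow.base x₀ (m + 1)) (1 : James x₀))
    (ha : ∀ i j, HoClass.face x₀ i a = HoClass.face x₀ j a)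
    (hp : HoClass.padStar x₀ k (m + 1) a = 1) : ∃ b, qStar x₀ (m + 1) b = a := by
  induction d generalizing k a with
  | zero =>
    obtain rfl : k = m + 1 := hd
    refine ⟨1, ?_⟩
    rw [map_one, ← hp]
    exact HoClass.precomp_eq_self _ _ (CGPow.pad_self _) a
  | succ d ih =>
    have hk : k ≤ m := by omega
    obtain ⟨Φ, hb, hΦ, h1⟩ := HoClass.exists_rep_trivial_on_fatWedge N D
      (HoClass.padStar x₀ (k + 1) (m + 1) a) fun j => by
        rw [HoClass.precomp_erase, HoClass.face_padStar hk j a ha, hp, map_one]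
    obtain ⟨b, hbu⟩ := D.isUnit
      (HoClass.mk (hopMap (m + 1) Φ hΦ) (hopMap_base _ k.succ_ne_zero Φ hΦ))
    have h2 : HoClass.padStar x₀ (k + 1) (m + 1) (qStar x₀ (m + 1) b) =
        HoClass.padStar x₀ (k + 1) (m + 1) a := by
      rw [hbu, ← h1]
      exact congrArg (Quotient.mk _) (Subtype.ext (ContinuousMap.ext fun y =>
        hopMap_q_pad (by omega) Φ hΦ y))
    obtain ⟨c, hc⟩ := ih (k + 1) (by omega) (a * qStar x₀ (m + 1) ↑b⁻¹)
      (fun i j => by rw [map_mul, map_mul, ha i j, HoClass.face_qStar i j])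
      (by rw [map_mul, ← h2, ← map_mul, ← map_mul, Units.mul_inv, map_one, map_one])
    refine ⟨c * b, ?_⟩
    rw [map_mul, hc, mul_assoc, ← map_mul, Units.inv_mul, map_one, mul_one]

theorem HoClass.eq_one_of_subsingleton {Z : Type u} [TopologicalSpace Z]
    [CompactlyGeneratedSpace Z] [Subsingleton Z] {z₀ : Z} (a : HoClass z₀ (1 : James x₀)) :
    a = 1 := by
  obtain ⟨f, hf⟩ := a
  refine congrArg (Quotient.mk _) (Subtype.ext (ContinuousMap.ext fun z => ?_))
  rw [Subsingleton.elim z z₀]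
  exact hf

instance : Subsingleton (CGPow X 0) := inferInstanceAs (Subsingleton (Fin 0 → X))

include N D in
/-- The image of `[J_{m+1}(X), J(X)]` in `[X^{m+1}, J(X)]` is the equalizer of the faces. -/
theorem exists_qStar_eq {m : ℕ} (a : HoClass (CGPow.base x₀ (m + 1)) (1 : James x₀))
    (ha : ∀ i j, HoClass.face x₀ i a = HoClass.face x₀ j a) : ∃ b, qStar x₀ (m + 1) b = a :=
  exists_qStar_eq_of_padStar_eq_one N D (m + 1) 0 (by omega) a ha
    (HoClass.eq_one_of_subsingleton _)

end Surjectivity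

/-! ### Weak category and duplicated coordinates -/

section Relations

open unitInterval

variable {X : Type u} [TopologicalSpace X] {x₀ : X}

/-- A family of maps out of a smash square parametrised by a compact space is jointly continuous as
soon as it is so on compact families of pairs. -/
theorem SmashPow.continuous_lift_uncurry {k : ℕ} (S : CompHaus.{u}) {Y : Type u}
    [TopologicalSpace Y] (f : CGPow X k → S → Y)
    (hf : ∀ (K : CompHaus.{u}) (b : C(K, CGPow X k)), Continuous fun p : K × S => f (b p.1) p.2)
    (hr : ∀ a b, smashRel x₀ k a b → f a = f b) :
    Continuous fun p : SmashPow x₀ k × S => (Quot.lift f hr p.1 : S → Y) p.2 := by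
  have hs : ∀ a, Continuous (f a) := fun a =>
    (hf (CompHaus.of PUnit) (ContinuousMap.const _ a)).comp (Continuous.prodMk_right PUnit.unit)
  have hs' : ∀ w : SmashPow x₀ k, Continuous (Quot.lift f hr w : S → Y) := by
    rintro ⟨a⟩
    exact hs a
  let G : SmashPow x₀ k → C(S, Y) := fun w => ⟨_, hs' w⟩
  have hG : Continuous G := by
    refine continuous_coinduced_dom.2 ?_
    refine continuous_from_uCompactlyGeneratedSpace _ fun K q => ?_
    exact ContinuousMap.continuous_of_continuous_uncurry _ (hf K q)
  have : LocallyCompactSpace S := locallyCompactSpace_of_compact_t2 S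
  exact ContinuousMap.continuous_uncurry_of_continuous ⟨G, hG⟩

/-- The map of powers of `X` induced by a map of index sets. -/
def CGPow.reindex (X : Type u) [TopologicalSpace X] {k n : ℕ} (c : Fin k → Fin n) :
    C(CGPow X n, CGPow X k) :=
  CGPow.mkMap fun s => CGPow.coord (c s)

theorem CGPow.reindex_base {k n : ℕ} (c : Fin k → Fin n) :
    CGPow.reindex X c (CGPow.base x₀ n) = CGPow.base x₀ k := rfl

/-- If the reduced diagonal of `X` is null homotopic, then a map on a power of `X` which is trivial
on the fat wedge becomes null homotopic after duplicating a coordinate. -/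
theorem homotopicRel_one_of_weakLSCatLT [CompactlyGeneratedSpace X] (hcat : WeakLSCatLT x₀ 2)
    {k n : ℕ} (Φ : C(CGPow X k, James x₀)) (hΦ : ∀ x ∈ fatWedge x₀ k, Φ x = 1)
    (c : Fin k → Fin n) {s t : Fin k} (hst : s ≠ t) (hc : c s = c t) :
    (Φ.comp (CGPow.reindex X c)).HomotopicRel (ContinuousMap.const _ 1) {CGPow.base x₀ n} := by
  obtain ⟨H⟩ := hcat
  -- The pair z is placed in positions s and t. As Φ is trivial on the fat wedge, Φ(A z x) depends
  -- only on the class of z in X ∧ X, and the diagonal value of z recovers the reindexing. The null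
  -- homotopy of the reduced diagonal can thus be applied to z.
  let A : CGPow X 2 → CGPow X n → CGPow X k := fun z x i =>
    if i = s then z 0 else if i = t then z 1 else x (c i)
  have hA : ∀ z x, (∃ i, z i = x₀) → Φ (A z x) = 1 := by
    rintro z x ⟨i, hi⟩
    refine hΦ _ ?_
    revert hi
    refine Fin.cases (fun hi => ⟨s, ?_⟩) (fun i hi => ⟨t, ?_⟩) i
    · simpa [A] using hi
    · obtain rfl : i = 0 := Subsingleton.elim _ _
      simpa [A, hst.symm] using hi
  have hA0 : ∀ x : CGPow X n, A (fun _ => x (c s)) x = CGPow.reindex X c x := by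
    refine fun x => funext fun i => ?_
    change (if i = s then x (c s) else if i = t then x (c s) else x (c i)) = x (c i)
    split_ifs with h1 h2
    · rw [h1]
    · rw [h2, hc]
    · rfl
  let B : CGPow X n → SmashPow x₀ 2 → James x₀ := fun x => Quot.lift (fun z => Φ (A z x))
    fun a b h => (hA a x h.1).trans (hA b x h.2).symm
  have hB : ∀ x, B x (SmashPow.base x₀ 2) = 1 := fun x =>
    hA (fun _ => x₀) x ⟨0, rfl⟩
  refine .of_map (fun p => B p.2 (H (p.1, p.2 (c s)))) ?_ (fun x => ?_) (fun x => ?_) ?_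
  -- Joint continuity in the smash variable and the parameter is tested on compact S.
  · refine continuous_from_uCompactlyGeneratedSpace _ fun S q => ?_
    have h1 := SmashPow.continuous_lift_uncurry (x₀ := x₀) S
      (fun (z : CGPow X 2) p => Φ (A z (q p).2)) (fun K b => Φ.continuous.comp
        (CGPow.continuous_of_compHaus (CompHaus.of (K × S)) _ fun i => ?_))
      fun a b h => funext fun p => (hA a _ h.1).trans (hA b _ h.2).symm
    · have h2 : Continuous fun p : S => H ((q p).1, (q p).2 (c s)) :=
        H.continuous.comp ((continuous_fst.comp q.continuous).prodMk
          ((CGPow.continuous_apply (c s)).comp (continuous_snd.comp q.continuous)))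
      have h3 := h1.comp (h2.prodMk continuous_id)
      refine h3.congr fun p => ?_
      change (Quot.lift _ _ (H ((q p).1, (q p).2 (c s))) : S → James x₀) p =
        Quot.lift _ _ (H ((q p).1, (q p).2 (c s)))
      generalize H ((q p).1, (q p).2 (c s)) = w
      obtain ⟨z⟩ := w
      rfl
    · have h2 := b.continuous.comp (continuous_fst (X := K) (Y := S))
      have h3 := (continuous_snd.comp q.continuous).comp (continuous_snd (X := K) (Y := S))
      simp only [A]
      split_ifs
      · exact (CGPow.continuous_apply 0).comp h2
      · exact (CGPow.continuous_apply 1).comp h2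
      · exact (CGPow.continuous_apply (c i)).comp h3
  · simp only [H.apply_zero]
    exact congrArg Φ (hA0 x)
  · simp only [H.apply_one]
    exact hB x
  · rintro τ x rfl
    refine (congrArg (B _) (H.eq_snd τ rfl)).trans ((hB _).trans (hΦ _ ⟨s, rfl⟩).symm)

end Relations

/-! ### The classes x_i and their commutators -/

section Classes

variable {X : Type u} [TopologicalSpace X] [CompactlyGeneratedSpace X] {x₀ : X}

theorem HoClass.face_xClass_same {n : ℕ} (j : Fin (n + 1)) :
    HoClass.face x₀ j (xClass x₀ j) = 1 := by
  refine congrArg (Quotient.mk _) (Subtype.ext (ContinuousMap.ext fun y => ?_))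
  exact (congrArg (James.of x₀) (CGPow.incl_same j y)).trans James.of_base

theorem HoClass.face_xClass_succAbove {n : ℕ} (j : Fin (n + 1)) (i : Fin n) :
    HoClass.face x₀ j (xClass x₀ (j.succAbove i)) = xClass x₀ i :=
  congrArg (Quotient.mk _) (Subtype.ext (ContinuousMap.ext fun y =>
    congrArg (James.of x₀) (CGPow.incl_succAbove j y i)))

variable (N : NDRData x₀) (D : James.Inversion x₀)

/-- The invertible class `x_i`. -/
noncomputable def James.Inversion.xUnit {n : ℕ} (i : Fin n) :
    (HoClass (CGPow.base x₀ n) (1 : James x₀))ˣ := (D.isUnit (xClass x₀ i)).unit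

theorem James.Inversion.coe_xUnit {n : ℕ} (i : Fin n) :
    (D.xUnit i : HoClass (CGPow.base x₀ n) (1 : James x₀)) = xClass x₀ i :=
  IsUnit.unit_spec _

theorem James.Inversion.face_xUnit_same {n : ℕ} (j : Fin (n + 1)) :
    Units.map (HoClass.face x₀ j) (D.xUnit j) = 1 :=
  Units.ext (by rw [Units.coe_map, D.coe_xUnit]; exact HoClass.face_xClass_same j)

theorem James.Inversion.face_xUnit_succAbove {n : ℕ} (j : Fin (n + 1)) (i : Fin n) :
    Units.map (HoClass.face x₀ j) (D.xUnit (j.succAbove i)) = D.xUnit i :=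
  Units.ext (by
    rw [Units.coe_map, D.coe_xUnit, D.coe_xUnit]
    exact HoClass.face_xClass_succAbove j i)

theorem James.Inversion.reindex_xUnit {k n : ℕ} (c : Fin k → Fin n) (s : Fin k) :
    Units.map (HoClass.precomp (x₀ := x₀) (CGPow.reindex X c) (CGPow.reindex_base c))
      (D.xUnit s) = D.xUnit (c s) :=
  Units.ext (by
    rw [Units.coe_map, D.coe_xUnit, D.coe_xUnit]
    rfl)

-- The commutator of the l + 1 distinct coordinates is trivial on each face because one entry
-- becomes 1 there, so it has a representative trivial on the fat wedge. Reindexing by c yields the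
-- given commutator, and a repeated index makes that pullback null homotopic.
include N in
theorem James.Inversion.iterComm_xUnit_eq_one (hcat : WeakLSCatLT x₀ 2) {n : ℕ} (l : ℕ)
    (c : Fin (l + 1) → Fin n) (h : ∃ s t, s < t ∧ c s = c t) :
    (iterComm l fun s => D.xUnit (c s)) = 1 := by
  obtain ⟨s, t, hst, hc⟩ := h
  obtain ⟨Φ, hb, hΦ, h1⟩ := HoClass.exists_rep_trivial_on_fatWedge N D
    (Units.val (iterComm l (D.xUnit (n := l + 1)))) fun j => by
      have h2 : Units.map (HoClass.face x₀ j) (iterComm l D.xUnit) = 1 := by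
        rw [map_iterComm]
        exact iterComm_eq_one l _ ⟨j, D.face_xUnit_same j⟩
      have h3 : HoClass.face x₀ j (Units.val (iterComm l D.xUnit)) = 1 := congrArg Units.val h2
      rw [HoClass.precomp_erase, h3, map_one]
  have h3 : (iterComm l fun s => D.xUnit (c s)) =
      Units.map (HoClass.precomp (x₀ := x₀) (CGPow.reindex X c) (CGPow.reindex_base c))
        (iterComm l D.xUnit) := by
    rw [map_iterComm]
    exact congrArg _ (funext fun s => (D.reindex_xUnit c s).symm)
  rw [h3]
  refine Units.ext ?_
  rw [Units.coe_map]
  refine (congrArg _ h1.symm).trans ?_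
  exact Quotient.sound (homotopicRel_one_of_weakLSCatLT hcat Φ hΦ c hst.ne hc)

end Classes

/-! ### The representation of the Cohen group and the main theorem -/

section CohenRepresentation

variable {X : Type u} [TopologicalSpace X] [CompactlyGeneratedSpace X] {x₀ : X}
  (N : NDRData x₀) (D : James.Inversion x₀) (hcat : WeakLSCatLT x₀ 2)

/-- The homomorphism from the Cohen group to the invertible classes in `[X^n, J(X)]`. -/
noncomputable def cohenRep (n : ℕ) :
    CohenK n →* (HoClass (CGPow.base x₀ n) (1 : James x₀))ˣ :=
  PresentedGroup.toGroup (f := D.xUnit) (by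
    have h1 := D.iterComm_xUnit_eq_one N hcat (n := n)
    rintro r (⟨l, i, h, rfl⟩ | ⟨l, i, m, rfl⟩)
    · rw [map_iterComm]
      simp only [FreeGroup.lift_apply_of]
      exact h1 l i h
    · rw [map_mul, map_inv, map_zpow, map_iterComm, map_iterComm, mul_inv_eq_one]
      simp only [map_zpow, FreeGroup.lift_apply_of]
      exact iterComm_zpow h1 l i m)

theorem cohenRep_x {n : ℕ} (i : Fin n) : cohenRep N D hcat n (CohenK.x i) = D.xUnit i :=
  PresentedGroup.toGroup.of _

/-- Both sides are homomorphisms in a, compared on generators. Consequently elements of the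
combinatorial equalizer go to classes with equal faces. -/
theorem face_cohenRep {n : ℕ} (j : Fin (n + 1)) (a : CohenK (n + 1)) :
    HoClass.face x₀ j (cohenRep N D hcat (n + 1) a : HoClass (CGPow.base x₀ (n + 1)) (1 : James x₀)) =
      cohenRep N D hcat n (CohenK.d j a) := by
  suffices H : (Units.map (HoClass.face x₀ j)).comp (cohenRep N D hcat (n + 1)) =
      (cohenRep N D hcat n).comp (CohenK.d j) from
    congrArg Units.val (DFunLike.congr_fun H a)
  refine PresentedGroup.ext fun i => ?_
  have h1 : CohenK.d j (CohenK.x i) = CohenK.dGen j i := PresentedGroup.toGroup.of _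
  change Units.map (HoClass.face x₀ j) (cohenRep N D hcat (n + 1) (CohenK.x i)) =
    cohenRep N D hcat n (CohenK.d j (CohenK.x i))
  rw [h1, cohenRep_x, CohenK.dGen]
  obtain rfl | hi := eq_or_ne i j
  · rw [D.face_xUnit_same, Fin.insertNth_apply_same, map_one]
  · obtain ⟨i, rfl⟩ := Fin.exists_succAbove_eq hi
    rw [D.face_xUnit_succAbove, Fin.insertNth_apply_succAbove, cohenRep_x]

theorem cohenRep_mem_geomK {n : ℕ} (a : CohenK n) :
    (cohenRep N D hcat n a : HoClass (CGPow.base x₀ n) (1 : James x₀)) ∈ geomK x₀ n := by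
  refine ⟨cohenRep N D hcat n a, ?_, rfl⟩
  have h1 : (⊤ : Subgroup (CohenK n)) ≤ (Subgroup.closure
      {a : (HoClass (CGPow.base x₀ n) (1 : James x₀))ˣ | ∃ i,
        (a : HoClass (CGPow.base x₀ n) (1 : James x₀)) = xClass x₀ i}).comap
      (cohenRep N D hcat n) := by
    rw [← PresentedGroup.closure_range_of, Subgroup.closure_le]
    rintro _ ⟨i, rfl⟩
    exact Subgroup.subset_closure ⟨i, (congrArg Units.val (cohenRep_x N D hcat i)).trans
      (D.coe_xUnit i)⟩
  exact h1 (Subgroup.mem_top a)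

theorem exists_qStar_eq_cohenRep {n : ℕ} {a : CohenK n} (ha : a ∈ cohenH n) :
    ∃ b, qStar x₀ n b = cohenRep N D hcat n a := by
  cases n with
  | zero => exact ⟨1, ((map_one _).trans (HoClass.eq_one_of_subsingleton _).symm)⟩
  | succ n =>
    refine exists_qStar_eq N D _ fun i j => ?_
    rw [face_cohenRep, face_cohenRep]
    rw [cohenH, Subgroup.mem_iInf] at ha
    exact congrArg (fun a => (cohenRep N D hcat n a).val) ((Subgroup.mem_iInf.1 (ha i)) j)

end CohenRepresentation

theorem proposition2p7 {X : Type u} [TopologicalSpace X] [CompactlyGeneratedSpace X]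
    [PathConnectedSpace X] (x₀ : X) (hx₀ : NondegenerateBasepoint x₀)
    (hCW : HasCWHomotopyType X) (hcat : WeakLSCatLT x₀ 2) (n : ℕ) :
    (∀ a : HoClass (CGPow.base x₀ n) (1 : James x₀), IsUnit a) ∧
    (∀ b : HoClass (JamesFil.base x₀ n) (1 : James x₀), IsUnit b) ∧
    ∃ (eK : CohenK n →* HoClass (CGPow.base x₀ n) (1 : James x₀)) (eH : cohenH n →* geomH x₀ n),
      (∀ i, eK (CohenK.x i) = xClass x₀ i) ∧
      (∀ a, eK a ∈ geomK x₀ n) ∧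
      ∀ a : cohenH n, qStar x₀ n (eH a : HoClass (JamesFil.base x₀ n) (1 : James x₀)) = eK a := by
  obtain ⟨χ, G, hχ, hG0, hG1, hGb⟩ := James.exists_leftInverse hx₀ hCW
  let D : James.Inversion x₀ := ⟨χ, G, hχ, hG0, hG1, hGb⟩
  obtain ⟨v, h, hv, h0, hb, h1⟩ := hx₀
  let N : NDRData x₀ := ⟨v, h, (hv x₀).2 rfl, h0, hb, h1⟩
  refine ⟨D.isUnit, D.isUnit, (Units.coeHom _).comp (cohenRep N D hcat n), ?_⟩
  -- The preimages are chosen arbitrarily; injectivity of q_n^* makes the choice unique, hence a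
  -- homomorphism.
  choose e he using fun a : cohenH n => exists_qStar_eq_cohenRep N D hcat a.2
  have hK := cohenRep_mem_geomK N D hcat (n := n)
  refine ⟨⟨⟨fun a => ⟨e a, ?_⟩, ?_⟩, fun a b => ?_⟩, fun i => ?_, hK, he⟩
  · change qStar x₀ n (e a) ∈ geomK x₀ n
    rw [he]
    exact hK _
  · refine Subtype.ext (qStar_injective N D n ?_)
    exact (he 1).trans ((congrArg Units.val (map_one _)).trans (map_one _).symm)
  · refine Subtype.ext (qStar_injective N D n ?_)
    exact (he _).trans ((congrArg Units.val (map_mul _ _ _)).trans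
      ((congrArg₂ (· * ·) (he a) (he b)).symm.trans (map_mul _ _ _).symm))
  · exact (congrArg Units.val (cohenRep_x N D hcat i)).trans (D.coe_xUnit i)
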